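/- Let $n\ge 0$, and let $\mathfrak S_n$ be the symmetric group on $[n]=\{1,\dots,n\}$. Let $\mathcal K_n\subseteq\mathfrak S_n$ be the geometric grid class of the matrix $$\begin{pmatrix}1&0\\0&1\\-1&0\\0&-1\end{pmatrix}.$$ That is, in a $4\times 2$ array of unit squares draw in each square the diagonal of slope $1$ if the matrix entry in that position is $1$, the diagonal of slope $-1$ if it is $-1$, and nothing if it is $0$. Then $\mathcal K_n$ is the set of all permutations obtained by placing $n$ dots on the drawn segments, no two with the same $x$- or $y$-coordinate, labeling the dots $1,\dots,n$ by increasing $y$-coordinate, and reading the labels by increasing $x$-coordinate. For $\pi\in\mathfrak S_n$ let $\mathrm{Des}(\pi)=\{i\in[n-1]:\pi(i)>\pi(i+1)\}$. For $D\subseteq[n-1]$ let $$F_{n,D}=\sum_{\substack{i_1\le\dots\le i_n\\ i_j<i_{j+1}\text{ if }j\in D}}x_{i_1}\cdots x_{i_n},$$ and set $\mathcal Q(\mathcal K_n)=\sum_{\pi\in\mathcal K_n}F_{n,\mathrm{Des}(\pi)}$. Let $s_\lambda$ denote the Schur function of the partition $\lambda$. Then $\mathcal K_n$ is fine, i.e.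 $\mathcal Q(\mathcal K_n)$ is a symmetric function and a linear combination of Schur functions with nonnegative coefficients. Moreover, if $n\ge 2$, then $$\mathcal Q(\mathcal K_n)=s_n+s_{1^n}+2\sum_{k=1}^{n-2}s_{n-k,1^k}+2\sum_{k=1}^{n-3}s_{n-k-1,2,1^{k-1}},$$ where empty sums are $0$. -/

import Mathlib

noncomputable section

namespace StackedGrid

/-! ### Descents and quasisymmetric functions -/

/-- The descent set `{i : π(i) > π(i+1)} ⊆ {1, …, n-1}` of a permutation, with positions numbered
from `1`: the element `b` of `Fin n` stands for the position `b + 1`, so `a`, `b` below are the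
positions `i` and `i + 1`. -/
def Des {n : ℕ} (π : Equiv.Perm (Fin n)) : Set ℕ :=
  {i | ∃ a b : Fin n, (a : ℕ) + 1 = i ∧ (b : ℕ) = i ∧ π b < π a}

/-- The fundamental quasisymmetric function `F_{n,D}` in the variables `x_0, x_1, x_2, …`: the sum
of `x_{i_1} ⋯ x_{i_n}` over all `i_1 ≤ ⋯ ≤ i_n` with `i_j < i_{j+1}` whenever `j ∈ D`.
The coefficient at a monomial counts the sequences whose product is this monomial. -/
def fundamental (n : ℕ) (D : Set ℕ) : MvPowerSeries ℕ ℚ := fun m =>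
  (Nat.card {s : Fin n → ℕ // Monotone s ∧
    (∀ a b : Fin n, (a : ℕ) + 1 = (b : ℕ) → (b : ℕ) ∈ D → s a < s b) ∧
    ∑ k, Finsupp.single (s k) 1 = m} : ℚ)

/-- `Q(B) = ∑_{π ∈ B} F_{n, Des π}` for a set `B` of permutations. -/
def quasi {n : ℕ} (B : Set (Equiv.Perm (Fin n))) : MvPowerSeries ℕ ℚ :=
  ∑ π ∈ B.toFinite.toFinset, fundamental n (Des π)

/-! ### Symmetric functions, Schur functions, fine sets -/

/-- Invariance of a power series under all permutations of the variables. -/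
def IsSymmetric (f : MvPowerSeries ℕ ℚ) : Prop :=
  ∀ (σ : Equiv.Perm ℕ) (m : ℕ →₀ ℕ),
    MvPowerSeries.coeff (m.mapDomain σ) f = MvPowerSeries.coeff m f

/-- The Schur function `s_μ`: the generating function of the semistandard Young tableaux of
shape `μ` by content, the entry `i` being recorded by the variable `x_i`. -/
def schur (μ : YoungDiagram) : MvPowerSeries ℕ ℚ := fun m =>
  (Nat.card {T : SemistandardYoungTableau μ //
    ∑ c ∈ μ.cells, Finsupp.single (T c.1 c.2) 1 = m} : ℚ)

/-- A nonnegative linear combination of Schur functions. -/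
def IsSchurPositive (f : MvPowerSeries ℕ ℚ) : Prop :=
  ∃ c : YoungDiagram →₀ ℚ, (∀ μ, 0 ≤ c μ) ∧ f = c.sum fun μ a => a • schur μ

/-- A set of permutations is fine if its quasisymmetric function is symmetric and
Schur-positive. -/
def IsFine {n : ℕ} (B : Set (Equiv.Perm (Fin n))) : Prop :=
  IsSymmetric (quasi B) ∧ IsSchurPositive (quasi B)

/-- The Young diagram of the partition with the given parts (in any order): its row lengths from
top to bottom are the given numbers in weakly decreasing order. -/
def shape (parts : List ℕ) : YoungDiagram :=
  YoungDiagram.ofRowLens (parts.insertionSort (· ≥ ·)) List.sortedGE_insertionSort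

/-! ### Geometric grid classes -/

/-- The grid of a matrix with entries in `{0, 1, -1}` and rows listed from top to bottom, as a
subset of the plane: the entry in row `i` and column `j` (numbered from `0`) belongs to the unit
square `[j, j+1] × [r-1-i, r-i]`, which carries the diagonal of slope `1` for an entry `1`, that
of slope `-1` for an entry `-1`, and nothing for an entry `0`. -/
def gridFigure {r c : ℕ} (M : Matrix (Fin r) (Fin c) SignType) : Set (ℝ × ℝ) :=
  {p | ∃ (i : Fin r) (j : Fin c), ∃ t ∈ Set.Icc (0 : ℝ) 1,
    (M i j = 1 ∧ p = ((j : ℝ) + t, (r : ℝ) - 1 - (i : ℝ) + t)) ∨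
    (M i j = -1 ∧ p = ((j : ℝ) + t, (r : ℝ) - (i : ℝ) - t))}

/-- The permutations of length `n` in the geometric grid class of `M`: those that arise from `n`
dots on the grid, no two with equal `x`- or `y`-coordinate, by labelling the dots by increasing
`y`-coordinate and reading the labels by increasing `x`-coordinate. Here `p k` is the `k`-th dot
from the left. -/
def gridClass {r c : ℕ} (M : Matrix (Fin r) (Fin c) SignType) (n : ℕ) :
    Set (Equiv.Perm (Fin n)) :=
  {π | ∃ p : Fin n → ℝ × ℝ, (∀ k, p k ∈ gridFigure M) ∧
    StrictMono (fun k => (p k).1) ∧ Function.Injective (fun k => (p k).2) ∧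
    ∀ k l, π k < π l ↔ (p k).2 < (p l).2}

/-- The stacked grid class `𝒦_n`: a one-column decreasing grid placed below the `2`-colayered
grid. -/
def classK (n : ℕ) : Set (Equiv.Perm (Fin n)) :=
  gridClass (!![1, 0; 0, 1; -1, 0; 0, -1] : Matrix (Fin 4) (Fin 2) SignType) n

end StackedGrid

end

namespace StackedGrid

open Finset

/-! ### From permutations to words -/

/-! The coefficient of a monomial `m` in `quasi B` counts the words of content `m` whose stable
sorting permutation lies in `B` (`coeff_quasi`). For the stacked grid, reading the dots from bottom
to top turns membership into a condition on the word: a strictly decreasing block `A`, then weakly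
increasing blocks `B` and `C` with all letters of `B` above all letters of `C`
(`sort_mem_classK_iff`).

The blocks are not unique, but the longest strictly decreasing prefix is. Unless the whole word
decreases, which needs `m` squarefree, the word is determined by the letter set `D` of that prefix
and the next letter `f`, since the remaining letters are increasing up to a rotation that starts
with `f`. So the coefficient is the number of pairs `(D, f)` with `f` not below all of `D`, plus the
squarefree indicator ε (`card_stackedList`).

Symmetry: dropping the condition on `f` gives an order-free count, and the pairs so added number 2^ℓ
- 1, where ℓ is the number of distinct letters (`card_allPairs`).

Schur expansion: let `a` be the least letter. A tableau of hook shape is a choice of `k` of the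
other ℓ - 1 letters for the column; for a near-hook one also chooses the entry of the cell `(1, 1)`,
and the first row is forced (`coeff_schur_nearHook`). Splitting the pairs `(D, f)` by whether `a ∈
D` counts every near-hook tableau twice, up to a remainder 2^ℓ - 1 - 2ε (`card_wordData_add`). With
the extra ε this remainder is exactly what the hooks contribute, because the binomial coefficients
of ℓ - 1 add up to 2^(ℓ-1) (`sum_choose_card_support`). -/

lemma sum_single_eq_iff {ι : Type*} (s : Finset ι) (f : ι → ℕ) (m : ℕ →₀ ℕ) :
    ∑ k ∈ s, Finsupp.single (f k) 1 = m ↔ s.val.map f = Finsupp.toMultiset m := by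
  have hinj : Function.Injective (Finsupp.toMultiset : (ℕ →₀ ℕ) → Multiset ℕ) :=
    Multiset.toFinsupp.symm.injective
  rw [← hinj.eq_iff, map_sum]
  simp only [Finsupp.toMultiset_single, one_nsmul]
  have h := Multiset.map_map (fun x : ℕ => ({x} : Multiset ℕ)) f s.val
  simp only [Function.comp_def] at h
  rw [Finset.sum, ← h, Multiset.sum_map_singleton]

/-- Ties in a word are broken from left to right: `π` sorts `s ∘ π⁻¹` exactly when `s` is weakly
increasing and strictly increasing at the descents of `π`. -/
lemma eq_sort_comp_symm_iff {n : ℕ} (π : Equiv.Perm (Fin n)) (s : Fin n → ℕ) :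
    π = Tuple.sort (s ∘ π.symm) ↔ Monotone s ∧
      ∀ a b : Fin n, (a : ℕ) + 1 = (b : ℕ) → (b : ℕ) ∈ Des π → s a < s b := by
  rw [Tuple.eq_sort_iff]
  have hs : (s ∘ π.symm) ∘ π = s := by ext; simp
  rw [hs]
  simp only [Function.comp, Equiv.symm_apply_apply]
  refine and_congr_right fun hm => ⟨fun h a b hab hb => ?_, fun h i j hij heq => ?_⟩
  · obtain ⟨a', b', ha', hb', hlt⟩ := hb
    obtain rfl : a' = a := Fin.ext (by omega)
    obtain rfl : b' = b := Fin.ext (by omega)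
    have hab' : a' < b' := Fin.lt_def.2 (by omega)
    refine lt_of_le_of_ne (hm hab'.le) fun he => ?_
    exact absurd (h a' b' hab' he) (not_lt.2 hlt.le)
  -- Equal values of `s` at two positions force equality at all positions between them, so none of
  -- these is a descent and `π` increases step by step along the interval.
  · have key : ∀ d : ℕ, ∀ j : Fin n, (i : ℕ) + d + 1 = j → s i = s j → π i < π j := by
      intro d
      induction d with
      | zero =>
        intro j hj he
        have hij : i < j := Fin.lt_def.2 (by omega)
        by_contra hlt
        have hlt' : π j < π i := lt_of_le_of_ne (not_lt.1 hlt) fun h' => hij.ne' (π.injective h')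
        exact absurd (h i j (by omega) ⟨i, j, by omega, rfl, hlt'⟩) (by omega)
      | succ d ih =>
        intro j hj he
        let k : Fin n := ⟨i + d + 1, by omega⟩
        have hik : i ≤ k := Fin.le_def.2 (by simp only [k]; omega)
        have hkj : k < j := Fin.lt_def.2 (by simp only [k]; omega)
        have h1 : s i = s k := le_antisymm (hm hik) (he ▸ hm hkj.le)
        refine (ih k rfl h1).trans ?_
        by_contra hlt
        have hlt' : π j < π k := lt_of_le_of_ne (not_lt.1 hlt) fun h' => hkj.ne' (π.injective h')
        have := h k j (by simp only [k]; omega) ⟨k, j, by simp only [k]; omega, rfl, hlt'⟩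
        omega
    exact key (j - i - 1) j (by have := Fin.lt_def.1 hij; omega) heq

/-- Finiteness allows the sum over `π` of cardinals in `coeff_quasi` to be merged into the cardinal
of one sigma type. -/
lemma finite_content {n : ℕ} (M : Multiset ℕ) :
    Finite {w : Fin n → ℕ // univ.val.map w = M} := by
  refine Finite.of_injective (β := Fin n → M.toFinset)
    (fun w k => ⟨w.1 k, Multiset.mem_toFinset.2 ?_⟩) fun w w' h => ?_
  · exact w.2.subst (motive := fun N => w.1 k ∈ N) (Multiset.mem_map_of_mem _ (mem_univ k))
  · ext k
    simpa using congrFun h k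

/-- Standardization: a pair `(π, s)` corresponds to the word `s ∘ π⁻¹`, and a word `w` gives back `π
= Tuple.sort w` and `s = w ∘ π`. -/
lemma coeff_quasi {n : ℕ} (B : Set (Equiv.Perm (Fin n))) (m : ℕ →₀ ℕ) :
    MvPowerSeries.coeff m (quasi B) =
      (Nat.card {w : Fin n → ℕ // univ.val.map w = Finsupp.toMultiset m ∧ Tuple.sort w ∈ B} : ℚ) := by
  classical
  have hfin (π : Equiv.Perm (Fin n)) : Finite {s : Fin n → ℕ // Monotone s ∧
      (∀ a b : Fin n, (a : ℕ) + 1 = (b : ℕ) → (b : ℕ) ∈ Des π → s a < s b) ∧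
      ∑ k, Finsupp.single (s k) 1 = m} := by
    have := finite_content (n := n) (Finsupp.toMultiset m)
    refine Finite.of_injective (β := {w : Fin n → ℕ // univ.val.map w = Finsupp.toMultiset m})
      (fun s => ⟨s.1, (sum_single_eq_iff _ _ _).1 s.2.2.2⟩) fun s s' h => ?_
    exact Subtype.ext (Subtype.mk.inj h)
  rw [quasi, map_sum]
  change ∑ π ∈ B.toFinite.toFinset, (Nat.card _ : ℚ) = _
  rw [← Nat.cast_sum, ← Finset.sum_coe_sort, ← Nat.card_sigma]
  congr 1
  have hperm (w : Fin n → ℕ) (π : Equiv.Perm (Fin n)) : univ.val.map (w ∘ π) = univ.val.map w := by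
    rw [← Multiset.map_map, Multiset.map_univ_val_equiv]
  refine Nat.card_congr
    { toFun := fun x => ⟨x.2.1 ∘ x.1.1.symm, ?_, ?_⟩
      invFun := fun w => ⟨⟨Tuple.sort w.1, by simpa using w.2.2⟩, w.1 ∘ Tuple.sort w.1, ?_⟩
      left_inv := ?_
      right_inv := ?_ }
  · rw [hperm]
    exact (sum_single_eq_iff _ _ _).1 x.2.2.2.2
  · rw [← (eq_sort_comp_symm_iff _ _).2 ⟨x.2.2.1, x.2.2.2.1⟩]
    simpa using x.1.2
  · have h := (eq_sort_comp_symm_iff (Tuple.sort w.1) (w.1 ∘ Tuple.sort w.1)).1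
      (by congr 1; ext; simp)
    refine ⟨h.1, h.2, ?_⟩
    rw [sum_single_eq_iff, hperm]
    exact w.2.1
  · rintro ⟨⟨π, hπ⟩, s, hs⟩
    have h := (eq_sort_comp_symm_iff _ _).2 ⟨hs.1, hs.2.1⟩
    have h' : Tuple.sort (s ∘ ⇑(Equiv.symm π)) = π := h.symm
    refine Sigma.subtype_ext (Subtype.ext h') ?_
    ext k
    simp [h']
  · rintro ⟨w, hw⟩
    ext k
    simp

/-! ### The grid -/

/-- The words of the stacked grid: up to the threshold `d` they decrease strictly, between `d` and
`e` and from `e` on they increase weakly, and the letters between `d` and `e` exceed the letters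
from `e` on. -/
def IsStacked {n : ℕ} {α : Type*} [LinearOrder α] (w : Fin n → α) : Prop :=
  ∃ d e : ℕ, d ≤ e ∧ ∀ i j : Fin n, i < j → ((j : ℕ) < d → w j < w i) ∧
    (d ≤ (i : ℕ) → (j : ℕ) < e → w i ≤ w j) ∧ (e ≤ (i : ℕ) → w i ≤ w j) ∧
    (d ≤ (i : ℕ) → (i : ℕ) < e → e ≤ (j : ℕ) → w j < w i)

/-- Every clause of `IsStacked` is a comparison `w i ≤ w j` with `i < j`, or its negation. This
transfers the property between a word and its standardization. -/
lemma isStacked_congr {n : ℕ} {α β : Type*} [LinearOrder α] [LinearOrder β] {v : Fin n → α}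
    {w : Fin n → β} (h : ∀ i j, i < j → (v i ≤ v j ↔ w i ≤ w j)) : IsStacked v ↔ IsStacked w := by
  have h' : ∀ i j, i < j → (v j < v i ↔ w j < w i) := fun i j hij => by
    rw [← not_le, ← not_le, h i j hij]
  refine exists_congr fun d => exists_congr fun e => and_congr_right fun _ =>
    forall_congr' fun i => forall_congr' fun j => forall_congr' fun hij => ?_
  rw [h i j hij, h' i j hij]

lemma sort_symm_le_iff {n : ℕ} (w : Fin n → ℕ) {i j : Fin n} (hij : i < j) :
    (Tuple.sort w).symm i ≤ (Tuple.sort w).symm j ↔ w i ≤ w j := by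
  obtain ⟨hm, ht⟩ := Tuple.eq_sort_iff.1 (rfl : Tuple.sort w = Tuple.sort w)
  refine ⟨fun h => by simpa using hm h, fun h => ?_⟩
  by_contra! hlt
  have h1 := hm hlt.le
  have h2 := ht _ _ hlt
  simp only [Function.comp, Equiv.apply_symm_apply] at h1 h2
  exact absurd (h2 (le_antisymm h1 h)) hij.not_gt

lemma exists_threshold {n : ℕ} (P : Fin n → Prop) (h : ∀ u v, u < v → P v → P u) :
    ∃ d : ℕ, ∀ v : Fin n, (v : ℕ) < d ↔ P v := by
  classical
  have hex : ∃ d : ℕ, ∀ v : Fin n, d ≤ (v : ℕ) → ¬ P v := ⟨n, fun v hv => by omega⟩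
  refine ⟨Nat.find hex, fun v => ⟨fun hv => ?_, fun hv => ?_⟩⟩
  · by_contra hP
    refine Nat.find_min hex hv fun u hu hPu => ?_
    rcases hu.eq_or_lt with h' | h'
    · exact hP (Fin.ext h' ▸ hPu)
    · exact hP (h v u h' hPu)
  · by_contra! hle
    exact Nat.find_spec hex v hle hv

/-- The two cells of slope `-1` join into one antidiagonal across both columns, which leaves three
segments in three horizontal strips. -/
lemma mem_gridFigure_iff (p : ℝ × ℝ) :
    p ∈ gridFigure (!![1, 0; 0, 1; -1, 0; 0, -1] : Matrix (Fin 4) (Fin 2) SignType) ↔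
      (p.1 + p.2 = 2 ∧ 0 ≤ p.1 ∧ p.1 ≤ 2) ∨ (p.2 = p.1 + 1 ∧ 1 ≤ p.1 ∧ p.1 ≤ 2) ∨
        (p.2 = p.1 + 3 ∧ 0 ≤ p.1 ∧ p.1 ≤ 1) := by
  obtain ⟨x, y⟩ := p
  constructor
  · rintro ⟨i, j, t, ⟨h0, h1⟩, h⟩
    fin_cases i <;> fin_cases j <;> simp [Prod.ext_iff] at h <;> obtain ⟨rfl, rfl⟩ := h
    · right; right; norm_num; exact ⟨by ring, h0, h1⟩
    · right; left; norm_num; exact ⟨by ring, h0, by linarith⟩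
    · left; norm_num; exact ⟨h0, by linarith⟩
    · left; norm_num; exact ⟨by linarith, by linarith⟩
  · rintro (⟨h, h0, h2⟩ | ⟨h, h0, h2⟩ | ⟨h, h0, h2⟩) <;> simp only at h h0 h2
    · rcases le_total x 1 with hx | hx
      · exact ⟨2, 0, x, ⟨h0, hx⟩, Or.inr ⟨by simp, by ext <;> simp; linarith⟩⟩
      · refine ⟨3, 1, x - 1, ⟨by linarith, by linarith⟩, Or.inr ⟨by simp, ?_⟩⟩
        ext <;> simp; linarith
    · refine ⟨1, 1, x - 1, ⟨by linarith, by linarith⟩, Or.inl ⟨by simp, ?_⟩⟩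
      ext <;> simp; linarith
    · refine ⟨0, 0, x, ⟨by linarith, by linarith⟩, Or.inl ⟨by simp, ?_⟩⟩
      ext <;> simp; linarith

lemma isStacked_of_mem_classK {n : ℕ} {π : Equiv.Perm (Fin n)} (hπ : π ∈ classK n) :
    IsStacked π.symm := by
  obtain ⟨p, hp, hx, -, hy⟩ := hπ
  simp only [mem_gridFigure_iff] at hp
  -- Dots are indexed by height from here on: `π.symm v` is the horizontal rank of the dot with
  -- label `v`.
  set x : Fin n → ℝ := fun v => (p (π.symm v)).1 with hxdef
  set y : Fin n → ℝ := fun v => (p (π.symm v)).2 with hydef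
  have hxlt : ∀ u v, π.symm u < π.symm v ↔ x u < x v := fun u v => (hx.lt_iff_lt).symm
  have hylt : ∀ u v, u < v → y u < y v := fun u v h =>
    (hy (π.symm u) (π.symm v)).1 (by simpa using h)
  have hc : ∀ v, (x v + y v = 2 ∧ 0 ≤ x v ∧ x v ≤ 2) ∨ (y v = x v + 1 ∧ 1 ≤ x v ∧ x v ≤ 2) ∨
      (y v = x v + 3 ∧ 0 ≤ x v ∧ x v ≤ 1) := fun v => hp _
  obtain ⟨d, hd⟩ := exists_threshold (fun v => x v + y v = 2) (fun u v huv h => by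
    have h1 := hylt u v huv
    rcases hc u with h' | h' | h' <;> rcases hc v with h'' | h'' | h'' <;> linarith)
  obtain ⟨e, he⟩ := exists_threshold (fun v => y v ≠ x v + 3) (fun u v huv h h' => by
    have h1 := hylt u v huv
    rcases hc u with h2 | h2 | h2 <;> rcases hc v with h3 | h3 | h3 <;>
      first | exact h h3.1 | linarith)
  -- Taking `min d e` yields the required inequality of thresholds without comparing `d` and `e`.
  refine ⟨min d e, e, min_le_right _ _, fun i j hij => ?_⟩
  have h1 := hylt i j hij
  have hne : x i ≠ x j := fun h => hij.ne (π.symm.injective (hx.injective h))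
  refine ⟨fun hj => ?_, fun hi hj => ?_, fun hi => ?_, fun hi hi' hj => ?_⟩
  · have hjd := (hd j).1 (lt_of_lt_of_le hj (min_le_left _ _))
    have hid := (hd i).1 (lt_of_lt_of_le (lt_trans hij hj) (min_le_left _ _))
    rw [hxlt]; linarith
  · have hje := (he j).1 hj
    have hid : ¬ (x i + y i = 2) := fun h => by
      have := (hd i).2 h
      have := Fin.lt_def.1 hij
      omega
    refine ((hxlt i j).2 ?_).le
    rcases hc i with h2 | h2 | h2 <;> rcases hc j with h3 | h3 | h3 <;>
      first | exact absurd h3.1 hje | exact absurd h2.1 hid | linarith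
  · have hie : y i = x i + 3 := by
      by_contra h
      exact absurd ((he i).2 h) (not_lt.2 hi)
    have hje : y j = x j + 3 := by
      by_contra h
      exact absurd ((he j).2 h) (not_lt.2 (hi.trans (Fin.le_def.1 hij.le)))
    exact ((hxlt i j).2 (by linarith)).le
  · have hid : ¬ (x i + y i = 2) := fun h => by
      have := (hd i).2 h
      omega
    have hie := (he i).1 hi'
    have hje : y j = x j + 3 := by
      by_contra h
      exact absurd ((he j).2 h) (not_lt.2 hj)
    rw [hxlt]
    refine lt_of_le_of_ne ?_ hne.symm
    rcases hc i with h2 | h2 | h2 <;> rcases hc j with h3 | h3 | h3 <;>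
      first | exact absurd h2.1 hid | exact absurd h2.1 hie | linarith

lemma mem_classK_of_isStacked {n : ℕ} {π : Equiv.Perm (Fin n)} (hπ : IsStacked π.symm) :
    π ∈ classK n := by
  classical
  obtain ⟨d, e, hde, h⟩ := hπ
  -- The vertical line between the two columns is drawn just to the right of the last dot of the top
  -- strip. The antidiagonal crosses both columns, so its dots impose no condition on this choice.
  let left : Fin n → Prop := fun k => ∃ v : Fin n, e ≤ (v : ℕ) ∧ k ≤ π.symm v
  -- Adding `1` to numerator and denominator keeps all coordinates strictly inside the unit
  -- interval, away from the cell boundaries.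
  let t : Fin n → ℝ := fun k => ((k : ℕ) + 1 : ℝ) / (n + 1)
  have hn : (0 : ℝ) < n + 1 := by positivity
  have ht0 : ∀ k, 0 < t k := fun k => by positivity
  have ht1 : ∀ k, t k < 1 := fun k => by
    rw [div_lt_one hn]
    have : ((k : ℕ) : ℝ) < n := by exact_mod_cast k.2
    linarith
  have htm : ∀ k l : Fin n, k < l → t k < t l := fun k l hkl => by
    have : ((k : ℕ) : ℝ) < (l : ℕ) := by exact_mod_cast hkl
    exact (div_lt_div_iff_of_pos_right hn).2 (by linarith)
  let x : Fin n → ℝ := fun k => if left k then t k else 1 + t k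
  have hxm : StrictMono x := fun k l hkl => by
    have := htm k l hkl
    by_cases hl : left l
    · have hk : left k := hl.imp fun v hv => ⟨hv.1, hkl.le.trans hv.2⟩
      simpa only [x, if_pos hl, if_pos hk] using this
    · by_cases hk : left k
      · simp only [x, if_neg hl, if_pos hk]
        linarith [ht0 l, ht1 k]
      · simp only [x, if_neg hl, if_neg hk]
        linarith
  have hx0 : ∀ k, 0 < x k ∧ x k < 2 := fun k => by
    have h0 := ht0 k
    have h1 := ht1 k
    simp only [x]
    split_ifs <;> constructor <;> linarith
  have hxtop : ∀ v : Fin n, e ≤ (v : ℕ) → x (π.symm v) < 1 := fun v hv => by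
    have : left (π.symm v) := ⟨v, hv, le_rfl⟩
    simpa only [x, if_pos this] using ht1 _
  -- Dots of the middle strip lie to the right of all dots of the top strip, hence in the second
  -- column.
  have hxmid : ∀ v : Fin n, d ≤ (v : ℕ) → (v : ℕ) < e → 1 < x (π.symm v) := fun v hv hve => by
    have : ¬ left (π.symm v) := by
      rintro ⟨u, hu, hvu⟩
      exact absurd ((h v u (Fin.lt_def.2 (by omega))).2.2.2 hv hve hu) (not_lt.2 hvu)
    simp only [x, if_neg this]
    linarith [ht0 (π.symm v)]
  let y : Fin n → ℝ := fun v =>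
    if (v : ℕ) < d then 2 - x (π.symm v) else
      if (v : ℕ) < e then x (π.symm v) + 1 else x (π.symm v) + 3
  have hym : StrictMono y := fun i j hij => by
    have hij' := Fin.lt_def.1 hij
    obtain ⟨h1, h2, h3, h4⟩ := h i j hij
    have hne : π.symm i ≠ π.symm j := fun h' => hij.ne (π.symm.injective h')
    have hi0 := hx0 (π.symm i)
    have hj0 := hx0 (π.symm j)
    have hi1 := hxmid i
    have hj1 := hxmid j
    simp only [y]
    split_ifs with hid hjd hje hie hjd hje hjd hje
    · linarith [hxm (h1 hjd)]
    · linarith [hj1 (by omega) hje]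
    · linarith
    · omega
    · linarith [hxm (lt_of_le_of_ne (h2 (by omega) hje) hne)]
    · linarith
    · omega
    · omega
    · linarith [hxm (lt_of_le_of_ne (h3 (by omega)) hne)]
  refine ⟨fun k => (x k, y (π k)), fun k => ?_, hxm, fun k l hkl => ?_, fun k l => ?_⟩
  · rw [mem_gridFigure_iff]
    have h0 := hx0 k
    have h1 := hxmid (π k)
    have h2 := hxtop (π k)
    simp only [y, Equiv.symm_apply_apply] at h1 h2 ⊢
    split_ifs with hd he
    · left; refine ⟨?_, ?_, ?_⟩ <;> linarith
    · right; left; have := h1 (by omega) he; refine ⟨rfl, ?_, ?_⟩ <;> linarith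
    · right; right; have := h2 (by omega); refine ⟨rfl, ?_, ?_⟩ <;> linarith
  · exact π.injective (hym.injective hkl)
  · exact hym.lt_iff_lt.symm

lemma sort_mem_classK_iff {n : ℕ} (w : Fin n → ℕ) :
    Tuple.sort w ∈ classK n ↔ IsStacked w := by
  rw [← isStacked_congr fun i j hij => sort_symm_le_iff w hij]
  exact ⟨isStacked_of_mem_classK, mem_classK_of_isStacked⟩

/-! ### Stacked lists -/

/-- Lists that consist of a strictly decreasing part followed by two weakly increasing parts, the
letters of the former exceeding those of the latter. -/
def StackedList (L : List ℕ) : Prop :=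
  ∃ A B C : List ℕ, L = A ++ (B ++ C) ∧ A.Pairwise (· > ·) ∧ B.Pairwise (· ≤ ·) ∧
    C.Pairwise (· ≤ ·) ∧ ∀ b ∈ B, ∀ c ∈ C, c < b

lemma isStacked_get_iff (L : List ℕ) : IsStacked L.get ↔ StackedList L := by
  constructor
  · rintro ⟨d, e, hde, h⟩
    have h' : ∀ i j (hij : i < j) (hj : j < L.length), _ := fun i j hij hj =>
      h ⟨i, hij.trans hj⟩ ⟨j, hj⟩ hij
    simp only [List.get_eq_getElem] at h'
    refine ⟨L.take d, (L.drop d).take (e - d), L.drop e, ?_, ?_, ?_, ?_, ?_⟩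
    · have : L.drop e = (L.drop d).drop (e - d) := by rw [List.drop_drop]; congr 1; omega
      rw [this, List.take_append_drop, List.take_append_drop]
    · rw [List.pairwise_iff_getElem]
      intro i j hi hj hij
      have hj' := hj
      simp only [List.length_take] at hj'
      simp only [List.getElem_take]
      exact (h' i j hij (by omega)).1 (by omega)
    · rw [List.pairwise_iff_getElem]
      intro i j hi hj hij
      have hj' := hj
      simp only [List.length_take, List.length_drop] at hj'
      simp only [List.getElem_take, List.getElem_drop]
      exact (h' (d + i) (d + j) (by omega) (by omega)).2.1 (by omega) (by omega)
    · rw [List.pairwise_iff_getElem]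
      intro i j hi hj hij
      have hj' := hj
      simp only [List.length_drop] at hj'
      simp only [List.getElem_drop]
      exact (h' (e + i) (e + j) (by omega) (by omega)).2.2.1 (by omega)
    · intro b hb c hc
      obtain ⟨i, hi, rfl⟩ := List.mem_iff_getElem.1 hb
      obtain ⟨j, hj, rfl⟩ := List.mem_iff_getElem.1 hc
      have hi' := hi
      have hj' := hj
      simp only [List.length_take, List.length_drop] at hi' hj'
      simp only [List.getElem_take, List.getElem_drop]
      exact (h' (d + i) (e + j) (by omega) (by omega)).2.2.2 (by omega) (by omega) (by omega)
  · rintro ⟨A, B, C, rfl, hA, hB, hC, hBC⟩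
    refine ⟨A.length, A.length + B.length, by omega, ?_⟩
    rintro ⟨i, hi⟩ ⟨j, hj⟩ hij
    simp only [Fin.lt_def] at hij
    rw [List.pairwise_iff_getElem] at hA hB hC
    have hj' := hj
    simp only [List.length_append] at hj'
    simp only [List.get_eq_getElem]
    have eB (k : ℕ) (hk : k < (A ++ (B ++ C)).length) (h1 : A.length ≤ k)
        (h2 : k < A.length + B.length) : (A ++ (B ++ C))[k] = B[k - A.length] := by
      rw [List.getElem_append_right h1, List.getElem_append_left (by omega)]
    have eC (k : ℕ) (hk : k < (A ++ (B ++ C)).length) (h1 : A.length + B.length ≤ k) :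
        (A ++ (B ++ C))[k] = C[k - A.length - B.length]'(by
          simp only [List.length_append] at hk; omega) := by
      rw [List.getElem_append_right (by omega), List.getElem_append_right (by omega)]
    refine ⟨fun h1 => ?_, fun h1 h2 => ?_, fun h1 => ?_, fun h1 h2 h3 => ?_⟩
    · rw [List.getElem_append_left h1, List.getElem_append_left (hij.trans h1)]
      exact hA i j _ _ hij
    · rw [eB i hi h1 (by omega), eB j hj (by omega) h2]
      exact hB _ _ _ _ (by omega)
    · rw [eC i hi h1, eC j hj (by omega)]
      exact hC _ _ _ _ (by omega)
    · rw [eB i hi h1 h2, eC j hj h3]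
      exact hBC _ (List.getElem_mem _) _ (List.getElem_mem _)

lemma coeff_quasi_classK (n : ℕ) (m : ℕ →₀ ℕ) :
    MvPowerSeries.coeff m (quasi (classK n)) =
      (Nat.card {L : List ℕ // (L : Multiset ℕ) = Finsupp.toMultiset m ∧ L.length = n ∧
        StackedList L} : ℚ) := by
  rw [coeff_quasi]
  congr 1
  have hget (w : Fin n → ℕ) : IsStacked w ↔ StackedList (List.ofFn w) := by
    rw [← isStacked_get_iff]
    constructor
    · rintro ⟨d, e, hde, h⟩
      refine ⟨d, e, hde, fun i j hij => ?_⟩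
      have := h (i.cast List.length_ofFn) (j.cast List.length_ofFn) (by simpa using hij)
      simpa [Fin.cast] using this
    · rintro ⟨d, e, hde, h⟩
      refine ⟨d, e, hde, fun i j hij => ?_⟩
      have := h (i.cast List.length_ofFn.symm) (j.cast List.length_ofFn.symm) (by simpa using hij)
      simpa using this
  have hval (w : Fin n → ℕ) : univ.val.map w = (List.ofFn w : Multiset ℕ) := Fin.univ_val_map w
  have hofFn (L : List ℕ) (hL : L.length = n) :
      List.ofFn (fun k : Fin n => L.get (k.cast hL.symm)) = L := by
    subst hL; simp
  exact Nat.card_congr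
    { toFun := fun w => ⟨List.ofFn w.1, (hval w.1).symm.trans w.2.1, List.length_ofFn,
        (hget w.1).1 ((sort_mem_classK_iff w.1).1 w.2.2)⟩
      invFun := fun L => ⟨fun k => L.1.get (k.cast L.2.2.1.symm),
        (hval _).trans ((congrArg _ (hofFn L.1 L.2.2.1)).trans L.2.1),
        (sort_mem_classK_iff _).2 ((hget _).2 ((hofFn L.1 L.2.2.1).symm ▸ L.2.2.2))⟩
      left_inv := fun w => by ext k; simp
      right_inv := fun L => Subtype.ext (hofFn L.1 L.2.2.1) }

/-! ### Counting stacked lists by content -/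

lemma mem_toMultiset_sub_iff (m : ℕ →₀ ℕ) (D : Finset ℕ) (x : ℕ) :
    x ∈ Finsupp.toMultiset m - D.val ↔ x ∈ m.support ∧ (x ∈ D → 2 ≤ m x) := by
  rw [← Multiset.count_pos, Multiset.count_sub, Finsupp.count_toMultiset, Finsupp.mem_support_iff]
  by_cases h : x ∈ D
  · rw [Multiset.count_eq_one_of_mem D.nodup h]
    simp only [h, forall_const]
    omega
  · rw [Multiset.count_eq_zero_of_notMem h]
    simp only [h, false_implies, and_true]
    omega

lemma val_le_toMultiset {m : ℕ →₀ ℕ} {D : Finset ℕ} (h : D ⊆ m.support) :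
    D.val ≤ Finsupp.toMultiset m := by
  rw [Multiset.le_iff_subset D.nodup]
  intro x hx
  exact (Finsupp.mem_toMultiset m x).2 (h hx)

lemma multiset_sort_eq_of_pairwise {L : List ℕ} (h : L.Pairwise (· ≤ ·)) :
    (L : Multiset ℕ).sort = L :=
  List.Perm.eq_of_pairwise' (Multiset.pairwise_sort _ _) h
    (Multiset.coe_eq_coe.1 (Multiset.sort_eq _ _))

lemma multiset_sort_eq_cons {N : Multiset ℕ} {f : ℕ} (hf : f ∈ N) (h : ∀ x ∈ N, f ≤ x) :
    N.sort = f :: (N.erase f).sort := by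
  conv_lhs => rw [← Multiset.cons_erase hf]
  exact Multiset.sort_cons _ _ _ fun b hb => h b (Multiset.mem_of_mem_erase hb)

lemma sort_toFinset_of_pairwise_gt {L : List ℕ} (h : L.Pairwise (· > ·)) :
    L.toFinset.sort (· ≥ ·) = L := by
  have hnd : L.Nodup := h.imp fun h => h.ne'
  refine List.Perm.eq_of_pairwise' (Finset.pairwise_sort _ _) (h.imp fun h => h.le) ?_
  rw [← Multiset.coe_eq_coe, Finset.sort_eq, List.toFinset_val, hnd.dedup]

/-- Pairs of a set `D` of letters, each taken once, and of a letter `f` of the remaining multiset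
that is not smaller than all of `D`. -/
def wordData (m : ℕ →₀ ℕ) : Finset (Finset ℕ × ℕ) :=
  (m.support.powerset ×ˢ m.support).filter fun p =>
    (p.2 ∈ p.1 → 2 ≤ m p.2) ∧ ∃ x ∈ p.1, x ≤ p.2

/-- The letters of `D` in decreasing order, followed by the remaining letters in increasing order,
rotated so as to start with `f`. -/
noncomputable def stackedWord (m : ℕ →₀ ℕ) (p : Finset ℕ × ℕ) : List ℕ :=
  p.1.sort (· ≥ ·) ++
    (((Finsupp.toMultiset m - p.1.val).filter (p.2 ≤ ·)).sort ++
      ((Finsupp.toMultiset m - p.1.val).filter (· < p.2)).sort)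

lemma mem_wordData {m : ℕ →₀ ℕ} {p : Finset ℕ × ℕ} :
    p ∈ wordData m ↔ p.1 ⊆ m.support ∧ p.2 ∈ Finsupp.toMultiset m - p.1.val ∧
      ∃ x ∈ p.1, x ≤ p.2 := by
  rw [mem_toMultiset_sub_iff]
  simp only [wordData, mem_filter, mem_product, mem_powerset]
  tauto

lemma coe_stackedWord {m : ℕ →₀ ℕ} {p : Finset ℕ × ℕ} (hp : p.1 ⊆ m.support) :
    (stackedWord m p : Multiset ℕ) = Finsupp.toMultiset m := by
  simp only [stackedWord, ← Multiset.coe_add, Multiset.sort_eq, Finset.sort_eq]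
  have : (Finsupp.toMultiset m - p.1.val).filter (· < p.2) =
      (Finsupp.toMultiset m - p.1.val).filter (fun x => ¬ p.2 ≤ x) := by simp only [not_le]
  rw [this, Multiset.filter_add_not, add_tsub_cancel_of_le (val_le_toMultiset hp)]

lemma exists_stackedWord_eq {m : ℕ →₀ ℕ} {p : Finset ℕ × ℕ}
    (hp : p.2 ∈ Finsupp.toMultiset m - p.1.val) :
    ∃ R, stackedWord m p = p.1.sort (· ≥ ·) ++ p.2 :: R := by
  rw [stackedWord, multiset_sort_eq_cons (f := p.2) (Multiset.mem_filter.2 ⟨hp, le_rfl⟩)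
    (fun x hx => (Multiset.mem_filter.1 hx).2)]
  exact ⟨_, rfl⟩

lemma stackedList_stackedWord (m : ℕ →₀ ℕ) (p : Finset ℕ × ℕ) : StackedList (stackedWord m p) := by
  refine ⟨_, _, _, rfl, (Finset.sortedGT_sort p.1).pairwise, Multiset.pairwise_sort _ _,
    Multiset.pairwise_sort _ _, fun b hb c hc => ?_⟩
  rw [Multiset.mem_sort, Multiset.mem_filter] at hb hc
  exact hc.2.trans_le hb.2

/-- The condition on `f` says that appending it to `A` destroys strict decrease. So `A` is the
longest strictly decreasing prefix, and `f` is the letter that follows it. -/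
lemma append_cons_inj_of_pairwise_gt {A A' R R' : List ℕ} {f f' : ℕ} (hA : A.Pairwise (· > ·))
    (hA' : A'.Pairwise (· > ·)) (hf : ∃ x ∈ A, x ≤ f) (hf' : ∃ x ∈ A', x ≤ f')
    (h : A ++ f :: R = A' ++ f' :: R') : A = A' ∧ f = f' := by
  have key : ∀ {A as : List ℕ} {f : ℕ}, (A ++ f :: as).Pairwise (· > ·) → ¬ ∃ x ∈ A, x ≤ f := by
    rintro A as f h ⟨x, hx, hxf⟩
    exact absurd ((List.pairwise_append.1 h).2.2 x hx f (by simp)) (not_lt.2 hxf)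
  rcases List.append_eq_append_iff.1 h with ⟨as, h1, h2⟩ | ⟨as, h1, h2⟩
  · cases as with
    | nil => simp at h1 h2; exact ⟨h1.symm, h2.1⟩
    | cons a as =>
      simp only [List.cons_append, List.cons.injEq] at h2
      rw [h1, ← h2.1] at hA'
      exact absurd hf (key hA')
  · cases as with
    | nil => simp at h1 h2; exact ⟨h1, h2.1.symm⟩
    | cons a as =>
      simp only [List.cons_append, List.cons.injEq] at h2
      rw [h1, ← h2.1] at hA
      exact absurd hf' (key hA)

/-- As long as the letter after `A` is below all of `A`, it can be moved into `A`; the number of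
letters outside `A` drops, so this stops. -/
lemma StackedList.exists_maximal {L : List ℕ} (hL : StackedList L) : L.Pairwise (· > ·) ∨
    ∃ (A : List ℕ) (f : ℕ) (B C : List ℕ), L = A ++ ((f :: B) ++ C) ∧ A.Pairwise (· > ·) ∧
      (f :: B).Pairwise (· ≤ ·) ∧ C.Pairwise (· ≤ ·) ∧ (∀ b ∈ f :: B, ∀ c ∈ C, c < b) ∧
      ∃ x ∈ A, x ≤ f := by
  obtain ⟨A, B, C, rfl, hA, hB, hC, hBC⟩ := hL
  induction hN : B.length + C.length generalizing A B C with
  | zero =>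
    left
    have hB0 : B = [] := List.eq_nil_of_length_eq_zero (by omega)
    have hC0 : C = [] := List.eq_nil_of_length_eq_zero (by omega)
    simpa [hB0, hC0] using hA
  | succ N ih =>
    obtain ⟨f, B', C', hcons, hlen, hB', hC', hBC'⟩ : ∃ f B' C', B ++ C = (f :: B') ++ C' ∧
        B'.length + C'.length = N ∧ (f :: B').Pairwise (· ≤ ·) ∧ C'.Pairwise (· ≤ ·) ∧
        ∀ b ∈ f :: B', ∀ c ∈ C', c < b := by
      cases B with
      | nil =>
        cases C with
        | nil => simp at hN
        -- Once the second block is used up, the third takes its place and an empty third block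
        -- remains.
        | cons c C => exact ⟨c, C, [], by simp, by simpa using hN, hC, by simp, by simp⟩
      | cons f B => exact ⟨f, B, C, rfl, by simp at hN; omega, hB, hC, hBC⟩
    rw [hcons]
    by_cases hx : ∃ x ∈ A, x ≤ f
    · exact Or.inr ⟨A, f, B', C', rfl, hA, hB', hC', hBC', hx⟩
    · push Not at hx
      have := ih (A ++ [f]) B' C'
        (List.pairwise_append.2 ⟨hA, by simp, fun a ha b hb => by
          rw [List.mem_singleton.1 hb]; exact hx a ha⟩)
        hB'.of_cons hC' (fun b hb => hBC' b (List.mem_cons_of_mem _ hb)) hlen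
      simpa using this

/-- The letter `f` is the least of its block and exceeds all of `C`, so cutting the remaining
multiset at `f` recovers both blocks. -/
lemma exists_wordData {m : ℕ →₀ ℕ} {A B C : List ℕ} {f : ℕ}
    (hm : ((A ++ ((f :: B) ++ C) : List ℕ) : Multiset ℕ) = Finsupp.toMultiset m)
    (hA : A.Pairwise (· > ·)) (hB : (f :: B).Pairwise (· ≤ ·)) (hC : C.Pairwise (· ≤ ·))
    (hBC : ∀ b ∈ f :: B, ∀ c ∈ C, c < b) (hf : ∃ x ∈ A, x ≤ f) :
    ∃ p ∈ wordData m, stackedWord m p = A ++ ((f :: B) ++ C) := by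
  have hnd : A.Nodup := hA.imp fun h => h.ne'
  have hval : A.toFinset.val = (A : Multiset ℕ) := by rw [List.toFinset_val, hnd.dedup]
  have hsub : Finsupp.toMultiset m - A.toFinset.val = ((f :: B : List ℕ) : Multiset ℕ) + C := by
    rw [← hm, hval, ← Multiset.coe_add, ← Multiset.coe_add, add_tsub_cancel_left]
  have hfB : ∀ b ∈ f :: B, f ≤ b := by
    intro b hb
    rcases List.mem_cons.1 hb with rfl | hb
    · exact le_rfl
    · exact List.rel_of_pairwise_cons hB hb
  refine ⟨(A.toFinset, f), mem_wordData.2 ⟨fun x hx => ?_, ?_, ?_⟩, ?_⟩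
  · rw [← Finsupp.mem_toMultiset, ← hm]
    simp only [List.mem_toFinset] at hx
    simp [hx]
  · simp only [hsub]
    simp
  · simpa using hf
  · simp only [stackedWord, hsub, Multiset.filter_add]
    rw [sort_toFinset_of_pairwise_gt hA, Multiset.filter_eq_self.2 hfB,
      Multiset.filter_eq_nil.2 (fun c hc => not_le.2 (hBC f (by simp) c hc)),
      Multiset.filter_eq_nil.2 (fun b hb => not_lt.2 (hfB b hb)),
      Multiset.filter_eq_self.2 (fun c hc => hBC f (by simp) c hc), add_zero, zero_add,
      multiset_sort_eq_of_pairwise hB, multiset_sort_eq_of_pairwise hC]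

lemma coe_support_sort_eq_iff (m : ℕ →₀ ℕ) :
    (m.support.sort (· ≥ ·) : Multiset ℕ) = Finsupp.toMultiset m ↔ ∀ x, m x ≤ 1 := by
  rw [Finset.sort_eq]
  constructor
  · intro h x
    rw [← Finsupp.count_toMultiset, ← h]
    exact Multiset.nodup_iff_count_le_one.1 m.support.nodup x
  · intro h
    ext x
    rw [Finsupp.count_toMultiset]
    by_cases hx : x ∈ m.support
    · rw [Multiset.count_eq_one_of_mem m.support.nodup hx]
      have := Finsupp.mem_support_iff.1 hx
      have := h x
      omega
    · rw [Multiset.count_eq_zero_of_notMem hx, Finsupp.notMem_support_iff.1 hx]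

open Classical in
/-- The indicator function of the squarefree monomials. -/
noncomputable def squarefreeIndicator (m : ℕ →₀ ℕ) : ℕ := if ∀ x, m x ≤ 1 then 1 else 0

lemma card_stackedList (m : ℕ →₀ ℕ) :
    Nat.card {L : List ℕ // (L : Multiset ℕ) = Finsupp.toMultiset m ∧ StackedList L} =
      (wordData m).card + squarefreeIndicator m := by
  classical
  let E : Finset (List ℕ) := if ∀ x, m x ≤ 1 then {m.support.sort (· ≥ ·)} else ∅
  have hE : E.card = squarefreeIndicator m := by
    simp only [E, squarefreeIndicator]; split_ifs <;> simp
  have hinj : Set.InjOn (stackedWord m) (wordData m) := by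
    rintro ⟨D, f⟩ hp ⟨D', f'⟩ hp' h
    obtain ⟨-, h1, h2⟩ := mem_wordData.1 (mem_coe.1 hp)
    obtain ⟨-, h1', h2'⟩ := mem_wordData.1 (mem_coe.1 hp')
    obtain ⟨R, hR⟩ := exists_stackedWord_eq h1
    obtain ⟨R', hR'⟩ := exists_stackedWord_eq h1'
    rw [hR, hR'] at h
    obtain ⟨h3, h4⟩ := append_cons_inj_of_pairwise_gt (Finset.sortedGT_sort D).pairwise
      (Finset.sortedGT_sort D').pairwise (by simpa using h2) (by simpa using h2') h
    have := congrArg List.toFinset h3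
    simp only [Finset.sort_toFinset] at this
    exact Prod.ext this h4
  have hdisj : Disjoint ((wordData m).image (stackedWord m)) E := by
    rw [disjoint_left]
    intro L hL hLE
    obtain ⟨p, hp, rfl⟩ := mem_image.1 hL
    obtain ⟨-, h1, x, hx, hxf⟩ := mem_wordData.1 hp
    obtain ⟨R, hR⟩ := exists_stackedWord_eq h1
    simp only [E] at hLE
    split_ifs at hLE
    · rw [mem_singleton] at hLE
      have := (Finset.sortedGT_sort m.support).pairwise
      rw [← hLE, hR] at this
      exact absurd ((List.pairwise_append.1 this).2.2 x (by simpa using hx) p.2 (by simp))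
        (not_lt.2 hxf)
    · simp at hLE
  rw [← hE, ← card_image_of_injOn hinj, ← card_union_of_disjoint hdisj]
  refine Nat.subtype_card _ fun L => ?_
  rw [mem_union, mem_image]
  constructor
  · rintro (⟨p, hp, rfl⟩ | h)
    · exact ⟨coe_stackedWord (mem_wordData.1 hp).1, stackedList_stackedWord m p⟩
    · simp only [E] at h
      split_ifs at h with h1
      · rw [mem_singleton.1 h]
        exact ⟨(coe_support_sort_eq_iff m).2 h1, _, [], [], by simp,
          (Finset.sortedGT_sort m.support).pairwise, by simp, by simp, by simp⟩
      · simp at h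
  · rintro ⟨hm, hL⟩
    rcases hL.exists_maximal with h | ⟨A, f, B, C, rfl, hA, hB, hC, hBC, hf⟩
    · right
      have hs : L.toFinset = m.support := by
        ext x
        rw [List.mem_toFinset, ← Multiset.mem_coe, hm, Finsupp.mem_toMultiset]
      have hL' : m.support.sort (· ≥ ·) = L := by
        rw [← hs, sort_toFinset_of_pairwise_gt h]
      have := (coe_support_sort_eq_iff m).1 (hL'.symm ▸ hm)
      simp only [E, if_pos this, mem_singleton, hL']
    · exact Or.inl (exists_wordData hm hA hB hC hBC hf)

lemma coeff_quasi_classK_eq (n : ℕ) (m : ℕ →₀ ℕ) :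
    MvPowerSeries.coeff m (quasi (classK n)) =
      if (Finsupp.toMultiset m).card = n then
        (((wordData m).card + squarefreeIndicator m : ℕ) : ℚ) else 0 := by
  rw [coeff_quasi_classK]
  split_ifs with h
  · rw [← card_stackedList]
    congr 1
    refine Nat.card_congr (Equiv.subtypeEquivRight fun L => ?_)
    refine and_congr_right fun hL => and_iff_right ?_
    rw [← h, ← hL, Multiset.coe_card]
  · rw [Nat.cast_eq_zero, Nat.card_eq_zero]
    refine Or.inl ⟨fun L => h ?_⟩
    rw [← L.2.1, Multiset.coe_card, L.2.2.1]

/-! ### Hooks and near-hooks -/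

/-- The diagram of the hook with arm `p` and leg `k`, together with the cell `(1, 1)` if `q`. -/
def IsNearHook (p k : ℕ) (q : Bool) (μ : YoungDiagram) : Prop :=
  (q = true → 1 ≤ p ∧ 1 ≤ k) ∧
  ∀ i j, (i, j) ∈ μ ↔ (i = 0 ∧ j ≤ p) ∨ (j = 0 ∧ i ≤ k) ∨ (q = true ∧ i = 1 ∧ j = 1)

lemma mem_shape_iff {L : List ℕ} (hL : L.Pairwise (· ≥ ·)) (i j : ℕ) :
    (i, j) ∈ shape L ↔ j < L.getD i 0 := by
  have h : L.insertionSort (· ≥ ·) = L := hL.insertionSort_eq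
  simp only [shape]
  rw [YoungDiagram.mem_ofRowLens]
  simp only [h]
  constructor
  · rintro ⟨h1, h2⟩
    rwa [List.getD_eq_getElem _ _ h1]
  · intro h2
    by_cases h1 : i < L.length
    · exact ⟨h1, by rwa [List.getD_eq_getElem _ _ h1] at h2⟩
    · rw [List.getD_eq_default _ _ (by omega)] at h2
      omega

lemma getD_replicate_one (k i : ℕ) :
    (List.replicate k 1).getD i 0 = if i < k then 1 else 0 := by
  rw [List.getD_eq_getElem?_getD, List.getElem?_replicate]
  split_ifs <;> rfl

lemma isNearHook_hook (p k : ℕ) :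
    IsNearHook p k false (shape ((p + 1) :: List.replicate k 1)) := by
  refine ⟨by simp, fun i j => ?_⟩
  rw [mem_shape_iff]
  · rcases i with _ | i
    · simp; omega
    · simp only [List.getD_cons_succ, getD_replicate_one]
      split_ifs <;> simp <;> omega
  · rw [List.pairwise_cons]
    refine ⟨fun b hb => ?_, by simp [List.pairwise_replicate]⟩
    rw [List.eq_of_mem_replicate hb]
    omega

lemma isNearHook_nearHook (p k : ℕ) :
    IsNearHook (p + 1) (k + 1) true (shape ((p + 2) :: 2 :: List.replicate k 1)) := by
  refine ⟨by simp, fun i j => ?_⟩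
  rw [mem_shape_iff]
  · rcases i with _ | _ | i
    · simp; omega
    · simp; omega
    · simp only [List.getD_cons_succ, getD_replicate_one]
      split_ifs <;> simp <;> omega
  · rw [List.pairwise_cons, List.pairwise_cons]
    refine ⟨fun b hb => ?_, fun b hb => ?_, by simp [List.pairwise_replicate]⟩
    · rcases List.mem_cons.1 hb with rfl | hb
      · omega
      · rw [List.eq_of_mem_replicate hb]
        omega
    · rw [List.eq_of_mem_replicate hb]
      omega

lemma IsNearHook.map_cells {p k : ℕ} {q : Bool} {μ : YoungDiagram} (hμ : IsNearHook p k q μ)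
    (T : ℕ → ℕ → ℕ) :
    μ.cells.val.map (fun c => T c.1 c.2) =
      T 0 0 ::ₘ ((((List.range p).map fun j => T 0 (j + 1) : List ℕ) : Multiset ℕ) +
        (((List.range k).map fun i => T (i + 1) 0 : List ℕ) : Multiset ℕ) +
        if q = true then {T 1 1} else 0) := by
  have h : μ.cells.val = (0, 0) ::ₘ ((Multiset.range p).map (fun j => (0, j + 1)) +
      (Multiset.range k).map (fun i => (i + 1, 0)) + if q = true then {(1, 1)} else 0) := by
    refine (Multiset.Nodup.ext μ.cells.nodup ?_).2 ?_
    · rw [Multiset.nodup_cons, Multiset.nodup_add, Multiset.nodup_add]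
      refine ⟨?_, ⟨?_, ?_, ?_⟩, ?_, ?_⟩
      · split_ifs <;> simp
      · exact (Multiset.nodup_range p).map fun a b h => by simpa using h
      · exact (Multiset.nodup_range k).map fun a b h => by simpa using h
      · rw [Multiset.disjoint_left]
        simp
      · split_ifs <;> simp
      · rw [Multiset.disjoint_left]
        intro c hc hc'
        split_ifs at hc'
        · rw [Multiset.mem_singleton] at hc'
          subst hc'
          simp at hc
        · simp at hc'
    · rintro ⟨i, j⟩
      rw [Finset.mem_val, YoungDiagram.mem_cells, hμ.2]
      have hq : ((i, j) ∈ (if q = true then {(1, 1)} else 0 : Multiset (ℕ × ℕ))) ↔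
          q = true ∧ i = 1 ∧ j = 1 := by split_ifs with h <;> simp [h]
      simp only [Multiset.mem_cons, Multiset.mem_add, hq, Multiset.mem_map, Multiset.mem_range,
        Prod.mk.injEq]
      constructor
      · rintro (⟨rfl, hj⟩ | ⟨rfl, hi⟩ | h)
        · rcases j with _ | j
          · simp
          · exact Or.inr (Or.inl (Or.inl ⟨j, by omega, rfl, rfl⟩))
        · rcases i with _ | i
          · simp
          · exact Or.inr (Or.inl (Or.inr ⟨i, by omega, rfl, rfl⟩))
        · exact Or.inr (Or.inr h)
      · rintro (⟨rfl, rfl⟩ | (⟨a, h, rfl, rfl⟩ | ⟨a, h, rfl, rfl⟩) | h)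
        · simp
        · left; omega
        · right; left; omega
        · exact Or.inr (Or.inr h)
  rw [h, Multiset.map_cons, Multiset.map_add, Multiset.map_add, Multiset.map_map,
    Multiset.map_map]
  congr 2
  split_ifs <;> simp

lemma IsNearHook.card_cells {p k : ℕ} {q : Bool} {μ : YoungDiagram} (hμ : IsNearHook p k q μ) :
    μ.cells.card = p + k + 1 + if q = true then 1 else 0 := by
  have := congrArg Multiset.card (hμ.map_cells fun _ _ => 0)
  simp only [Multiset.card_map, Multiset.card_cons, Multiset.card_add, Multiset.coe_card,
    List.length_map, List.length_range, Finset.card_val] at this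
  rw [this]
  split_ifs <;> simp

lemma schur_apply_eq_zero {μ : YoungDiagram} {m : ℕ →₀ ℕ}
    (h : μ.cells.card ≠ (Finsupp.toMultiset m).card) :
    MvPowerSeries.coeff m (schur μ) = 0 := by
  change (Nat.card _ : ℚ) = 0
  rw [Nat.cast_eq_zero, Nat.card_eq_zero]
  refine Or.inl ⟨fun T => h ?_⟩
  rw [← (sum_single_eq_iff _ _ _).1 T.2, Multiset.card_map, Finset.card_val]

/-- What remains of the multiset of letters after the removal of the corner `a` and of the set `C`
of the remaining letters of the first column. -/
noncomputable def rest (m : ℕ →₀ ℕ) (a : ℕ) (C : Finset ℕ) : Multiset ℕ :=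
  Finsupp.toMultiset m - (insert a C).val

/-- The data that determine a semistandard tableau of near-hook shape with corner entry `a`: the
set of the other letters of the first column and the entry of the cell `(1, 1)`, which is to be `0`
if this cell is missing. -/
def IsTableauData (m : ℕ →₀ ℕ) (a k : ℕ) (q : Bool) (x : Finset ℕ × ℕ) : Prop :=
  x.1 ⊆ m.support.erase a ∧ x.1.card = k ∧ if q = true then
    x.2 ∈ rest m a x.1 ∧ (∃ y ∈ x.1, y ≤ x.2) ∧ ∃ y ∈ rest m a x.1, y < x.2 else x.2 = 0

lemma map_range_getD (L : List ℕ) : (List.range L.length).map (L.getD · 0) = L := by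
  refine List.ext_getElem (by simp) fun i h1 h2 => ?_
  simp [h2]

lemma finset_sort_eq_of_pairwise_lt {L : List ℕ} (h : L.Pairwise (· < ·)) :
    L.toFinset.sort = L := by
  have hnd : L.Nodup := h.imp fun h => h.ne
  refine List.Perm.eq_of_pairwise' (Finset.pairwise_sort _ _) (h.imp fun h => h.le) ?_
  rw [← Multiset.coe_eq_coe, Finset.sort_eq, List.toFinset_val, hnd.dedup]

section Tableaux

variable {m : ℕ →₀ ℕ} {a p k : ℕ} {q : Bool} {μ : YoungDiagram}

lemma pairwise_map_range {r : ℕ → ℕ → Prop} {f : ℕ → ℕ} {n : ℕ}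
    (h : ∀ i j, i < j → j < n → r (f i) (f j)) : ((List.range n).map f).Pairwise r := by
  rw [List.pairwise_map]
  exact (List.pairwise_lt_range (n := n)).imp_of_mem fun _ hb h' => h _ _ h' (List.mem_range.1 hb)

lemma column_pairwise (hμ : IsNearHook p k q μ) (T : SemistandardYoungTableau μ) :
    ((List.range k).map fun i => T (i + 1) 0).Pairwise (· < ·) :=
  pairwise_map_range fun i j hij hj =>
    T.col_strict (by omega) ((hμ.2 _ _).2 (Or.inr (Or.inl ⟨rfl, by omega⟩)))

lemma row_pairwise (hμ : IsNearHook p k q μ) (T : SemistandardYoungTableau μ) :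
    ((List.range p).map fun j => T 0 (j + 1)).Pairwise (· ≤ ·) :=
  pairwise_map_range fun i j hij hj =>
    T.row_weak (by omega) ((hμ.2 _ _).2 (Or.inl ⟨rfl, by omega⟩))

lemma corner_eq (hμ : IsNearHook p k q μ) (ha : a ∈ m.support) (hmin : ∀ x ∈ m.support, a ≤ x)
    (T : SemistandardYoungTableau μ)
    (hT : μ.cells.val.map (fun c => T c.1 c.2) = Finsupp.toMultiset m) : T 0 0 = a := by
  apply le_antisymm
  · rw [← Finsupp.mem_toMultiset, ← hT, Multiset.mem_map] at ha
    obtain ⟨⟨i, j⟩, hc, rfl⟩ := ha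
    rw [Finset.mem_val, YoungDiagram.mem_cells] at hc
    exact (T.row_weak_of_le (Nat.zero_le j) (μ.up_left_mem (Nat.zero_le i) le_rfl hc)).trans
      (T.col_weak (Nat.zero_le i) hc)
  · refine hmin _ ((Finsupp.mem_toMultiset m _).1 ?_)
    rw [← hT, hμ.map_cells (fun i j => T i j)]
    exact Multiset.mem_cons_self _ _

/-- The corner and the column account for `a` and a set of further letters, each once; what is left
fills the first row and the cell `(1, 1)`. -/
lemma rest_eq (hμ : IsNearHook p k q μ) (ha : a ∈ m.support) (hmin : ∀ x ∈ m.support, a ≤ x)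
    (T : SemistandardYoungTableau μ)
    (hT : μ.cells.val.map (fun c => T c.1 c.2) = Finsupp.toMultiset m) :
    rest m a ((List.range k).map fun i => T (i + 1) 0).toFinset =
      (((List.range p).map fun j => T 0 (j + 1) : List ℕ) : Multiset ℕ) +
        if q = true then {T 1 1} else 0 := by
  have h00 := corner_eq hμ ha hmin T hT
  have hcol := column_pairwise hμ T
  have hnd : ((List.range k).map fun i => T (i + 1) 0).Nodup := hcol.imp fun h => h.ne
  have hnot : a ∉ ((List.range k).map fun i => T (i + 1) 0).toFinset := by
    simp only [List.mem_toFinset, List.mem_map, List.mem_range, not_exists, not_and]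
    rintro i hi h
    have := T.col_strict (show 0 < i + 1 by omega) ((hμ.2 (i + 1) 0).2 (Or.inr (Or.inl ⟨rfl, by omega⟩)))
    omega
  rw [rest, Finset.insert_val_of_notMem hnot, List.toFinset_val, hnd.dedup, ← hT,
    hμ.map_cells (fun i j => T i j), h00, ← Multiset.singleton_add, ← Multiset.singleton_add,
    tsub_add_eq_tsub_tsub, add_tsub_cancel_left, add_right_comm, add_tsub_cancel_right]

lemma isTableauData_of_tableau (hμ : IsNearHook p k q μ) (ha : a ∈ m.support)
    (hmin : ∀ x ∈ m.support, a ≤ x) (T : SemistandardYoungTableau μ)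
    (hT : μ.cells.val.map (fun c => T c.1 c.2) = Finsupp.toMultiset m) :
    IsTableauData m a k q (((List.range k).map fun i => T (i + 1) 0).toFinset, T 1 1) := by
  have h00 := corner_eq hμ ha hmin T hT
  have hcol := column_pairwise hμ T
  have hnd : ((List.range k).map fun i => T (i + 1) 0).Nodup := hcol.imp fun h => h.ne
  refine ⟨fun x hx => ?_, ?_, ?_⟩
  · simp only [List.mem_toFinset, List.mem_map, List.mem_range] at hx
    obtain ⟨i, hi, rfl⟩ := hx
    have hc : (i + 1, 0) ∈ μ := (hμ.2 (i + 1) 0).2 (Or.inr (Or.inl ⟨rfl, by omega⟩))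
    have := T.col_strict (show 0 < i + 1 by omega) hc
    refine mem_erase.2 ⟨by omega, ?_⟩
    rw [← Finsupp.mem_toMultiset, ← hT, Multiset.mem_map]
    exact ⟨(i + 1, 0), hc, rfl⟩
  · rw [List.toFinset_card_of_nodup hnd]
    simp
  · rw [rest_eq hμ ha hmin T hT]
    split_ifs with hq
    · obtain ⟨hp, hk⟩ := hμ.1 hq
      have hc : (1, 1) ∈ μ := (hμ.2 1 1).2 (Or.inr (Or.inr ⟨hq, rfl, rfl⟩))
      refine ⟨by simp, ⟨T 1 0, ?_, T.row_weak one_pos hc⟩, T 0 1, ?_, T.col_strict one_pos hc⟩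
      · simp only [List.mem_toFinset, List.mem_map, List.mem_range]
        exact ⟨0, hk, rfl⟩
      · rw [Multiset.mem_add, Multiset.mem_coe]
        exact Or.inl (List.mem_map.2 ⟨0, List.mem_range.2 hp, rfl⟩)
    · refine T.zeros fun h => ?_
      rcases (hμ.2 1 1).1 h with h | h | h
      · omega
      · omega
      · exact hq h.1

/-- Column and cell `(1, 1)` determine the multiset in the first row, and a weakly increasing row is
determined by its multiset. -/
lemma tableau_ext (hμ : IsNearHook p k q μ) (ha : a ∈ m.support) (hmin : ∀ x ∈ m.support, a ≤ x)
    (T T' : SemistandardYoungTableau μ)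
    (hT : μ.cells.val.map (fun c => T c.1 c.2) = Finsupp.toMultiset m)
    (hT' : μ.cells.val.map (fun c => T' c.1 c.2) = Finsupp.toMultiset m)
    (hcol : ((List.range k).map fun i => T (i + 1) 0).toFinset =
      ((List.range k).map fun i => T' (i + 1) 0).toFinset) (h11 : T 1 1 = T' 1 1) : T = T' := by
  have hrow : ((List.range p).map fun j => T 0 (j + 1)) =
      ((List.range p).map fun j => T' 0 (j + 1)) := by
    refine List.Perm.eq_of_pairwise' (row_pairwise hμ T) (row_pairwise hμ T') ?_
    have h := rest_eq hμ ha hmin T hT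
    rw [hcol, rest_eq hμ ha hmin T' hT', h11] at h
    exact Multiset.coe_eq_coe.1 (add_right_cancel h).symm
  have hcol' : ((List.range k).map fun i => T (i + 1) 0) =
      ((List.range k).map fun i => T' (i + 1) 0) := by
    rw [← finset_sort_eq_of_pairwise_lt (column_pairwise hμ T), hcol,
      finset_sort_eq_of_pairwise_lt (column_pairwise hμ T')]
  have h00 : T 0 0 = T' 0 0 := by rw [corner_eq hμ ha hmin T hT, corner_eq hμ ha hmin T' hT']
  rw [List.map_inj_left] at hrow hcol'
  refine SemistandardYoungTableau.ext fun i j => ?_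
  by_cases hc : (i, j) ∈ μ
  · rcases (hμ.2 i j).1 hc with ⟨rfl, hj⟩ | ⟨rfl, hi⟩ | ⟨-, rfl, rfl⟩
    · rcases j with _ | j
      · exact h00
      · exact hrow j (List.mem_range.2 (by omega))
    · rcases i with _ | i
      · exact h00
      · exact hcol' i (List.mem_range.2 (by omega))
    · exact h11
  · rw [T.zeros hc, T'.zeros hc]

/-- The filling of a near-hook with corner `a`, the rest of the first row given by `R`, the rest of
the first column given by `C`, and `r` in the cell `(1, 1)`. -/
def nearHookEntry (a : ℕ) (R C : List ℕ) (r i j : ℕ) : ℕ :=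
  if i = 0 then if j = 0 then a else R.getD (j - 1) 0
  else if j = 0 then C.getD (i - 1) 0 else if i = 1 ∧ j = 1 then r else 0

lemma getD_zero_le_of_mem {L : List ℕ} (hL : L.Pairwise (· ≤ ·)) {y : ℕ} (hy : y ∈ L) :
    L.getD 0 0 ≤ y := by
  cases L with
  | nil => simp at hy
  | cons b L =>
    rcases List.mem_cons.1 hy with rfl | hy
    · simp
    · simpa using List.rel_of_pairwise_cons hL hy

lemma getD_mem {L : List ℕ} {i : ℕ} (h : i < L.length) : L.getD i 0 ∈ L := by
  rw [List.getD_eq_getElem _ _ h]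
  exact List.getElem_mem h

lemma rel_getD_of_pairwise {r : ℕ → ℕ → Prop} {L : List ℕ} (hL : L.Pairwise r) {i j : ℕ}
    (hij : i < j) (hj : j < L.length) : r (L.getD i 0) (L.getD j 0) := by
  rw [List.getD_eq_getElem _ _ hj, List.getD_eq_getElem _ _ (hij.trans hj)]
  exact List.pairwise_iff_getElem.1 hL i j _ _ hij

/-- For the cell `(1, 1)` it is enough that some letter of `C` is at most `r` and some letter of `R`
is less than `r`: the lists are sorted, so their first entries, the neighbours of this cell, then
satisfy the same bounds. -/
lemma exists_tableau_of_lists (hμ : IsNearHook p k q μ) {R C : List ℕ} {r : ℕ}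
    (hRp : R.length = p) (hCk : C.length = k) (hR : R.Pairwise (· ≤ ·)) (hC : C.Pairwise (· < ·))
    (haR : ∀ x ∈ R, a ≤ x) (haC : ∀ x ∈ C, a < x) (hr0 : q = false → r = 0)
    (hrC : q = true → ∃ x ∈ C, x ≤ r) (hrR : q = true → ∃ x ∈ R, x < r) :
    ∃ T : SemistandardYoungTableau μ, T 0 0 = a ∧ ((List.range k).map fun i => T (i + 1) 0) = C ∧
      ((List.range p).map fun j => T 0 (j + 1)) = R ∧ T 1 1 = r := by
  subst hRp hCk
  let T : SemistandardYoungTableau μ :=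
    { entry := nearHookEntry a R C r
      row_weak' := by
        intro i j1 j2 hj hc
        rcases (hμ.2 i j2).1 hc with ⟨rfl, hj2⟩ | ⟨rfl, hi⟩ | ⟨hq, rfl, rfl⟩
        · rcases j2 with _ | j2
          · omega
          · rcases j1 with _ | j1
            · simpa [nearHookEntry] using haR _ (getD_mem (by omega))
            · simpa [nearHookEntry] using
                rel_getD_of_pairwise hR (show j1 < j2 by omega) (by omega)
        · omega
        · obtain rfl : j1 = 0 := by omega
          obtain ⟨x, hx, hxr⟩ := hrC hq
          simpa [nearHookEntry] using
            (getD_zero_le_of_mem (hC.imp fun h => h.le) hx).trans hxr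
      col_strict' := by
        intro i1 i2 j hi hc
        rcases (hμ.2 i2 j).1 hc with ⟨rfl, hj⟩ | ⟨rfl, hi2⟩ | ⟨hq, rfl, rfl⟩
        · omega
        · rcases i2 with _ | i2
          · omega
          · rcases i1 with _ | i1
            · simpa [nearHookEntry] using haC _ (getD_mem (by omega))
            · simpa [nearHookEntry] using
                rel_getD_of_pairwise hC (show i1 < i2 by omega) (by omega)
        · obtain rfl : i1 = 0 := by omega
          obtain ⟨x, hx, hxr⟩ := hrR hq
          simpa [nearHookEntry] using (getD_zero_le_of_mem hR hx).trans_lt hxr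
      zeros' := by
        intro i j hc
        rw [hμ.2] at hc
        push Not at hc
        obtain ⟨h1, h2, h3⟩ := hc
        simp only [nearHookEntry]
        split_ifs with hi hj hj h11
        · have := h1 hi; omega
        · have := h1 hi
          exact List.getD_eq_default _ _ (by omega)
        · have := h2 hj
          exact List.getD_eq_default _ _ (by omega)
        · refine hr0 ?_
          by_contra hq
          exact h3 (by simpa using hq) h11.1 h11.2
        · rfl }
  refine ⟨T, rfl, ?_, ?_, rfl⟩
  · conv_rhs => rw [← map_range_getD C]
    rfl
  · conv_rhs => rw [← map_range_getD R]
    rfl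

lemma exists_tableau_of_isTableauData (hμ : IsNearHook p k q μ) (ha : a ∈ m.support)
    (hmin : ∀ x ∈ m.support, a ≤ x)
    (hcard : (Finsupp.toMultiset m).card = p + k + 1 + if q = true then 1 else 0)
    {x : Finset ℕ × ℕ} (hx : IsTableauData m a k q x) :
    ∃ T : SemistandardYoungTableau μ,
      μ.cells.val.map (fun c => T c.1 c.2) = Finsupp.toMultiset m ∧
      (((List.range k).map fun i => T (i + 1) 0).toFinset, T 1 1) = x := by
  obtain ⟨C, r⟩ := x
  obtain ⟨hC, hk, hq⟩ := hx
  simp only at hC hk hq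
  -- The content of the cell `(1, 1)`, empty if the cell is missing.
  let I : Multiset ℕ := if q = true then {r} else 0
  have hI : I ≤ rest m a C := by
    simp only [I]
    split_ifs with h
    · rw [if_pos h] at hq
      exact Multiset.singleton_le.2 hq.1
    · exact Multiset.zero_le _
  have hIc : I.card = if q = true then 1 else 0 := by
    simp only [I]; split_ifs <;> simp
  have haC : a ∉ C := fun h => by simpa using hC h
  have hdecomp : Finsupp.toMultiset m = a ::ₘ (C.val + (I + (rest m a C - I))) := by
    rw [add_tsub_cancel_of_le hI, ← Multiset.cons_add, ← Finset.insert_val_of_notMem haC, rest,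
      add_tsub_cancel_of_le]
    refine val_le_toMultiset (insert_subset ha (hC.trans (erase_subset _ _)))
  have hmem : ∀ y ∈ rest m a C, y ∈ m.support := fun y hy =>
    ((mem_toMultiset_sub_iff m _ y).1 hy).1
  have hlen : (rest m a C - I).sort.length = p := by
    have := congrArg Multiset.card hdecomp
    simp only [Multiset.card_cons, Multiset.card_add, Finset.card_val, hIc] at this
    rw [Multiset.length_sort]
    omega
  have haR : ∀ y ∈ (rest m a C - I).sort, a ≤ y := fun y hy => by
    rw [Multiset.mem_sort] at hy
    exact hmin y (hmem y (Multiset.mem_of_le tsub_le_self hy))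
  have haC' : ∀ y ∈ C.sort, a < y := fun y hy => by
    rw [Finset.mem_sort] at hy
    have := mem_erase.1 (hC hy)
    exact lt_of_le_of_ne (hmin y this.2) this.1.symm
  -- The smaller letter `y` differs from `r`, so it survives when one copy of `r` is taken out for
  -- the cell `(1, 1)`.
  have hrR : q = true → ∃ y ∈ (rest m a C - I).sort, y < r := fun h => by
    rw [if_pos h] at hq
    obtain ⟨y, hy, hyr⟩ := hq.2.2
    refine ⟨y, ?_, hyr⟩
    rw [Multiset.mem_sort]
    simp only [I, if_pos h]
    rw [Multiset.sub_singleton]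
    exact (Multiset.mem_erase_of_ne hyr.ne).2 hy
  obtain ⟨T, h00, hcol, hrow, h11⟩ := exists_tableau_of_lists hμ hlen
    ((Finset.length_sort _).trans hk) (Multiset.pairwise_sort _ _)
    (Finset.sortedLT_sort C).pairwise haR haC' (fun h => by simpa [h] using hq)
    (fun h => by rw [if_pos h] at hq; simpa using hq.2.1) hrR
  refine ⟨T, ?_, ?_⟩
  · rw [hμ.map_cells (fun i j => T i j), h00, hcol, hrow, h11, hdecomp, Multiset.sort_eq,
      Finset.sort_eq]
    congr 1
    change _ + I = _
    rw [add_comm, add_comm _ C.val, add_left_comm]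
  · rw [hcol, h11, Finset.sort_toFinset]

lemma coeff_schur_nearHook (hμ : IsNearHook p k q μ) (ha : a ∈ m.support)
    (hmin : ∀ x ∈ m.support, a ≤ x)
    (hcard : (Finsupp.toMultiset m).card = p + k + 1 + if q = true then 1 else 0) :
    MvPowerSeries.coeff m (schur μ) =
      (Nat.card {x : Finset ℕ × ℕ // IsTableauData m a k q x} : ℚ) := by
  change (Nat.card _ : ℚ) = _
  congr 1
  refine Nat.card_congr (Equiv.ofBijective (fun T =>
    ⟨_, isTableauData_of_tableau hμ ha hmin T.1 ((sum_single_eq_iff _ _ _).1 T.2)⟩) ⟨?_, ?_⟩)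
  · intro T T' h
    have h' := Prod.mk.inj (Subtype.mk.inj h)
    exact Subtype.ext (tableau_ext hμ ha hmin T.1 T'.1 ((sum_single_eq_iff _ _ _).1 T.2)
      ((sum_single_eq_iff _ _ _).1 T'.2) h'.1 h'.2)
  · rintro ⟨x, hx⟩
    obtain ⟨T, hT, hTx⟩ := exists_tableau_of_isTableauData hμ ha hmin hcard hx
    exact ⟨⟨T, (sum_single_eq_iff _ _ _).2 hT⟩, Subtype.ext hTx⟩

end Tableaux

/-! ### Counting -/

lemma mem_rest_iff {m : ℕ →₀ ℕ} {a : ℕ} {C : Finset ℕ} {x : ℕ} :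
    x ∈ rest m a C ↔ x ∈ m.support ∧ (x ∈ insert a C → 2 ≤ m x) :=
  mem_toMultiset_sub_iff m _ x

/-- Pairs of a subset `C` of `S` and an element of `S` below all of `C`. -/
def pointedBelow (S : Finset ℕ) : Finset (Finset ℕ × ℕ) :=
  (S.powerset ×ˢ S).filter fun p => ∀ x ∈ p.1, p.2 < x

/-- Inserting the point into `C` makes it the minimum, so the pairs correspond to the nonempty
subsets of `S`. -/
lemma card_pointedBelow (S : Finset ℕ) : (pointedBelow S).card + 1 = 2 ^ S.card := by
  have h : (pointedBelow S).card = (S.powerset.erase ∅).card := by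
    refine card_bij (fun p _ => insert p.2 p.1) ?_ ?_ ?_
    · intro p hp
      simp only [pointedBelow, mem_filter, mem_product, mem_powerset] at hp
      exact mem_erase.2 ⟨insert_ne_empty _ _, mem_powerset.2 (insert_subset hp.1.2 hp.1.1)⟩
    · rintro ⟨C, f⟩ hp ⟨C', f'⟩ hp' h
      simp only [pointedBelow, mem_filter, mem_product, mem_powerset] at hp hp' h
      have hff : f = f' := by
        have h1 : f ∈ insert f' C' := h ▸ mem_insert_self _ _
        have h2 : f' ∈ insert f C := h ▸ mem_insert_self _ _
        rcases mem_insert.1 h1 with h1 | h1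
        · exact h1
        · rcases mem_insert.1 h2 with h2 | h2
          · exact h2.symm
          · exact absurd (hp.2 _ h2) (hp'.2 _ h1).not_gt
      subst hff
      have hC : f ∉ C := fun h => lt_irrefl _ (hp.2 _ h)
      have hC' : f ∉ C' := fun h => lt_irrefl _ (hp'.2 _ h)
      rw [← erase_insert hC, h, erase_insert hC']
    · intro D hD
      rw [mem_erase, mem_powerset, ← nonempty_iff_ne_empty] at hD
      obtain ⟨hne, hDS⟩ := hD
      refine ⟨(D.erase (D.min' hne), D.min' hne), ?_, insert_erase (min'_mem _ hne)⟩
      simp only [pointedBelow, mem_filter, mem_product, mem_powerset]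
      exact ⟨⟨(erase_subset _ _).trans hDS, hDS (min'_mem _ _)⟩,
        fun x hx => min'_lt_of_mem_erase_min' _ hne hx⟩
  rw [h, card_erase_of_mem (empty_mem_powerset _), card_powerset]
  have := Nat.two_pow_pos S.card
  omega

lemma two_mul_card_filter_mem_powerset {T : Finset ℕ} {b : ℕ} (hb : b ∈ T) :
    2 * (T.powerset.filter (b ∈ ·)).card = 2 ^ T.card := by
  have h : (T.powerset.filter (b ∈ ·)).card = (T.powerset.filter (b ∉ ·)).card := by
    refine card_nbij' (fun C => C.erase b) (fun C => insert b C) ?_ ?_ ?_ ?_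
    · intro C hC
      simp only [coe_filter, mem_powerset, Set.mem_ofPred_eq] at hC ⊢
      exact ⟨(erase_subset _ _).trans hC.1, notMem_erase _ _⟩
    · intro C hC
      simp only [coe_filter, mem_powerset, Set.mem_ofPred_eq] at hC ⊢
      exact ⟨insert_subset hb hC.1, mem_insert_self _ _⟩
    · intro C hC
      simp only [coe_filter, mem_powerset, Set.mem_ofPred_eq] at hC
      exact insert_erase hC.2
    · intro C hC
      simp only [coe_filter, mem_powerset, Set.mem_ofPred_eq] at hC
      exact erase_insert hC.2
  have := card_filter_add_card_filter_not (s := T.powerset) (b ∈ ·)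
  rw [card_powerset] at this
  omega

/-- Pairs of a set `C` of letters other than `a`, each taken once, and a letter `f` of the multiset
that remains after the removal of `a` and `C`. -/
def letterPairs (m : ℕ →₀ ℕ) (a : ℕ) : Finset (Finset ℕ × ℕ) :=
  ((m.support.erase a).powerset ×ˢ m.support).filter fun p =>
    p.2 ∈ insert a p.1 → 2 ≤ m p.2

/-- The pairs `(C, f)` of `letterPairs` such that `f` is not below all of `C`. -/
def columnPairs (m : ℕ →₀ ℕ) (a : ℕ) : Finset (Finset ℕ × ℕ) :=
  (letterPairs m a).filter fun p => ∃ x ∈ p.1, x ≤ p.2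

open Classical in
/-- The pairs `(C, f)` of `columnPairs` such that some remaining letter is smaller than `f`. -/
noncomputable def nearHookPairs (m : ℕ →₀ ℕ) (a : ℕ) : Finset (Finset ℕ × ℕ) :=
  (columnPairs m a).filter fun p => ∃ y ∈ rest m a p.1, y < p.2

section Counting

variable {m : ℕ →₀ ℕ} {a : ℕ}

lemma mem_letterPairs {p : Finset ℕ × ℕ} :
    p ∈ letterPairs m a ↔ p.1 ⊆ m.support.erase a ∧ p.2 ∈ rest m a p.1 := by
  rw [mem_rest_iff]
  simp only [letterPairs, mem_filter, mem_product, mem_powerset]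
  tauto

/-- If `a ∈ D`, the condition on `f` is automatic, and removing `a` from `D` leaves an arbitrary
letter pair. If `a ∉ D`, the condition forces `f ≠ a`, so it is immaterial whether a copy of `a` is
also set aside. -/
lemma card_wordData (ha : a ∈ m.support) (hmin : ∀ x ∈ m.support, a ≤ x) :
    (wordData m).card = (letterPairs m a).card + (columnPairs m a).card := by
  rw [← card_filter_add_card_filter_not (s := wordData m) (fun p => a ∈ p.1)]
  congr 1
  · refine card_nbij' (fun p => (p.1.erase a, p.2)) (fun p => (insert a p.1, p.2)) ?_ ?_ ?_ ?_
    · intro p hp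
      simp only [coe_filter, Set.mem_ofPred_eq, mem_wordData] at hp
      rw [mem_coe, mem_letterPairs]
      refine ⟨erase_subset_erase _ hp.1.1, ?_⟩
      rw [rest, insert_erase hp.2]
      exact hp.1.2.1
    · intro p hp
      rw [mem_coe, mem_letterPairs] at hp
      simp only [coe_filter, Set.mem_ofPred_eq, mem_wordData]
      exact ⟨⟨insert_subset ha (hp.1.trans (erase_subset _ _)), hp.2, a, mem_insert_self _ _,
        hmin _ (mem_rest_iff.1 hp.2).1⟩, mem_insert_self _ _⟩
    · intro p hp
      simp only [coe_filter, Set.mem_ofPred_eq] at hp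
      exact Prod.ext (insert_erase hp.2) rfl
    · intro p hp
      rw [mem_coe, mem_letterPairs] at hp
      exact Prod.ext (erase_insert fun h => notMem_erase _ _ (hp.1 h)) rfl
  · congr 1
    ext ⟨C, f⟩
    simp only [columnPairs, mem_filter, mem_wordData, mem_letterPairs, mem_rest_iff,
      mem_toMultiset_sub_iff, mem_insert, subset_erase]
    constructor
    · rintro ⟨⟨hC, hf, x, hx, hxf⟩, haC⟩
      refine ⟨⟨⟨hC, haC⟩, hf.1, ?_⟩, x, hx, hxf⟩
      rintro (rfl | h)
      · obtain rfl : x = f := le_antisymm hxf (hmin x (hC hx))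
        exact absurd hx haC
      · exact hf.2 h
    · rintro ⟨⟨⟨hC, haC⟩, hf, hf'⟩, x, hx, hxf⟩
      exact ⟨⟨hC, ⟨hf, fun h => hf' (Or.inr h)⟩, x, hx, hxf⟩, haC⟩

open Classical in
lemma card_wordData_eq (ha : a ∈ m.support) (hmin : ∀ x ∈ m.support, a ≤ x) :
    (wordData m).card = 2 * (nearHookPairs m a).card + 2 * ((columnPairs m a).filter fun p =>
      ¬ ∃ y ∈ rest m a p.1, y < p.2).card +
      ((letterPairs m a).filter fun p => ¬ ∃ x ∈ p.1, x ≤ p.2).card := by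
  have h1 := card_filter_add_card_filter_not (s := letterPairs m a) (fun p => ∃ x ∈ p.1, x ≤ p.2)
  have h2 := card_filter_add_card_filter_not (s := columnPairs m a)
    (fun p => ∃ y ∈ rest m a p.1, y < p.2)
  have h3 : (columnPairs m a).card =
      ((letterPairs m a).filter fun p => ∃ x ∈ p.1, x ≤ p.2).card := rfl
  have h4 : (nearHookPairs m a).card =
      ((columnPairs m a).filter fun p => ∃ y ∈ rest m a p.1, y < p.2).card := rfl
  rw [card_wordData ha hmin]
  omega

lemma filter_letterPairs_of_two_le (ha : a ∈ m.support) (hmin : ∀ x ∈ m.support, a ≤ x)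
    (h2 : 2 ≤ m a) :
    (letterPairs m a).filter (fun p => ¬ ∃ x ∈ p.1, x ≤ p.2) = pointedBelow m.support := by
  ext ⟨C, f⟩
  simp only [pointedBelow, mem_filter, mem_letterPairs, mem_rest_iff, mem_product, mem_powerset,
    not_exists, not_and, not_le, mem_insert, subset_erase]
  constructor
  · rintro ⟨⟨⟨hC, -⟩, hf, -⟩, h⟩
    exact ⟨⟨hC, hf⟩, h⟩
  · rintro ⟨⟨hC, hf⟩, h⟩
    refine ⟨⟨⟨hC, fun haC => ?_⟩, hf, ?_⟩, h⟩
    · exact absurd (h a haC) (hmin f hf).not_gt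
    · rintro (rfl | h')
      · exact h2
      · exact absurd (h f h') (lt_irrefl _)

lemma filter_letterPairs_of_lt_two (h2 : m a < 2) :
    (letterPairs m a).filter (fun p => ¬ ∃ x ∈ p.1, x ≤ p.2) =
      pointedBelow (m.support.erase a) := by
  ext ⟨C, f⟩
  simp only [pointedBelow, mem_filter, mem_letterPairs, mem_rest_iff, mem_product, mem_powerset,
    not_exists, not_and, not_le, mem_insert, mem_erase]
  constructor
  · rintro ⟨⟨hC, hf, hf'⟩, h⟩
    refine ⟨⟨hC, ?_, hf⟩, h⟩
    rintro rfl
    exact absurd (hf' (Or.inl rfl)) (not_le.2 h2)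
  · rintro ⟨⟨hC, hfa, hf⟩, h⟩
    refine ⟨⟨hC, hf, ?_⟩, h⟩
    rintro (h' | h')
    · exact absurd h' hfa
    · exact absurd (h f h') (lt_irrefl _)

/-- A second copy of `a` remains, and it is smaller than `f`, since `f` is at least some letter of
the column. -/
lemma filter_columnPairs_of_two_le (hmin : ∀ x ∈ m.support, a ≤ x) (ha : a ∈ m.support)
    (h2 : 2 ≤ m a) {p : Finset ℕ × ℕ} (hp : p ∈ columnPairs m a) :
    ∃ y ∈ rest m a p.1, y < p.2 := by
  obtain ⟨hp, x, hx, hxf⟩ := mem_filter.1 hp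
  have hx' := mem_erase.1 ((mem_letterPairs.1 hp).1 hx)
  exact ⟨a, mem_rest_iff.2 ⟨ha, fun _ => h2⟩,
    lt_of_lt_of_le (lt_of_le_of_ne (hmin x hx'.2) hx'.1.symm) hxf⟩

open Classical in
-- Here `f` is the least remaining letter, so `C` determines it. If `b` were not in `C`, it would
-- remain and give `f ≤ b`; but some letter of `C` is at most `f`, and it would have to be `b`.
lemma card_filter_columnPairs_of_lt_two (h2 : m a < 2) {b : ℕ} (hb : b ∈ m.support.erase a)
    (hbmin : ∀ x ∈ m.support.erase a, b ≤ x) :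
    ((columnPairs m a).filter fun p => ¬ ∃ y ∈ rest m a p.1, y < p.2).card =
      ((m.support.erase a).powerset.filter fun C => b ∈ C ∧ ∃ f, f ∈ rest m a C).card := by
  have hrest : ∀ {C f}, f ∈ rest m a C → f ∈ m.support.erase a := fun {C f} hf => by
    rw [mem_rest_iff] at hf
    refine mem_erase.2 ⟨?_, hf.1⟩
    rintro rfl
    exact absurd (hf.2 (mem_insert_self _ _)) (not_le.2 h2)
  refine card_bij (fun p _ => p.1) ?_ ?_ ?_
  · rintro ⟨C, f⟩ hp
    simp only [columnPairs, mem_filter, mem_letterPairs, not_exists, not_and, not_lt] at hp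
    obtain ⟨⟨⟨hC, hf⟩, x, hx, hxf⟩, hlt⟩ := hp
    refine mem_filter.2 ⟨mem_powerset.2 hC, ?_, f, hf⟩
    by_contra hbC
    have hbr : b ∈ rest m a C := mem_rest_iff.2 ⟨(mem_erase.1 hb).2, fun h => by
      rcases mem_insert.1 h with h | h
      · exact absurd h (mem_erase.1 hb).1
      · exact absurd h hbC⟩
    have h1 := hlt b hbr
    have h3 := hbmin x (hC hx)
    obtain rfl : x = b := by omega
    exact hbC hx
  · rintro ⟨C, f⟩ hp ⟨C', f'⟩ hp' h
    simp only [columnPairs, mem_filter, mem_letterPairs, not_exists, not_and, not_lt] at hp hp' h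
    subst h
    exact Prod.ext rfl (le_antisymm (hp.2 _ hp'.1.1.2) (hp'.2 _ hp.1.1.2))
  · intro C hC
    rw [mem_filter, mem_powerset] at hC
    obtain ⟨hCs, hbC, hex⟩ := hC
    refine ⟨(C, Nat.find hex), ?_, rfl⟩
    simp only [columnPairs, mem_filter, mem_letterPairs, not_exists, not_and, not_lt]
    exact ⟨⟨⟨hCs, Nat.find_spec hex⟩, b, hbC, hbmin _ (hrest (Nat.find_spec hex))⟩,
      fun y hy => Nat.find_min' hex hy⟩

open Classical in
-- No letter remains only if `m` is squarefree and `C` consists of all letters other than `a`; the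
-- indicator accounts for this one set.
lemma card_filter_rest_add {b : ℕ} (hb : b ∈ m.support.erase a) :
    ((m.support.erase a).powerset.filter fun C => b ∈ C ∧ ∃ f, f ∈ rest m a C).card +
      squarefreeIndicator m = ((m.support.erase a).powerset.filter (b ∈ ·)).card := by
  rw [← filter_filter]
  by_cases hsf : ∀ x, m x ≤ 1
  · have hmem : m.support.erase a ∈ (m.support.erase a).powerset.filter (b ∈ ·) :=
      mem_filter.2 ⟨mem_powerset.2 subset_rfl, hb⟩
    have h : ((m.support.erase a).powerset.filter (b ∈ ·)).filter
        (fun C => ∃ f, f ∈ rest m a C) =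
        ((m.support.erase a).powerset.filter (b ∈ ·)).erase (m.support.erase a) := by
      ext C
      simp only [mem_filter, mem_erase, mem_powerset, ne_eq, mem_rest_iff, mem_insert]
      constructor
      · rintro ⟨hC, f, hf, hf'⟩
        refine ⟨?_, hC⟩
        rintro rfl
        have := hf' (by by_cases h : f = a <;> simp_all)
        have := hsf f
        omega
      · rintro ⟨hne, hC⟩
        refine ⟨hC, ?_⟩
        by_contra! hall
        refine hne (subset_antisymm hC.1 fun x hx => ?_)
        obtain ⟨hxa, hx⟩ := mem_erase.1 hx
        exact (hall x hx).1.resolve_left hxa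
    rw [h, squarefreeIndicator, if_pos hsf, card_erase_add_one hmem]
  · rw [squarefreeIndicator, if_neg hsf, add_zero, filter_true_of_mem]
    intro C _
    push Not at hsf
    obtain ⟨x, hx⟩ := hsf
    exact ⟨x, mem_rest_iff.2 ⟨Finsupp.mem_support_iff.2 (by omega), fun _ => hx⟩⟩

lemma card_toMultiset_le_one (hS : m.support ⊆ {a}) (h2 : m a < 2) :
    (Finsupp.toMultiset m).card ≤ 1 := by
  rw [Finsupp.card_toMultiset, Finsupp.sum_of_support_subset m hS _ (by simp)]
  simp only [sum_singleton, id]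
  omega

lemma card_wordData_add (ha : a ∈ m.support) (hmin : ∀ x ∈ m.support, a ≤ x)
    (hn : 2 ≤ (Finsupp.toMultiset m).card) :
    (wordData m).card + 2 * squarefreeIndicator m + 1 =
      2 * (nearHookPairs m a).card + 2 ^ m.support.card := by
  classical
  rw [card_wordData_eq ha hmin]
  by_cases h2 : 2 ≤ m a
  · rw [filter_false_of_mem (s := columnPairs m a) fun p hp =>
      not_not.2 (filter_columnPairs_of_two_le hmin ha h2 hp),
      filter_letterPairs_of_two_le ha hmin h2, ← card_pointedBelow, squarefreeIndicator,
      if_neg fun h => absurd (h a) (by omega), card_empty]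
    omega
  · rw [not_le] at h2
    -- Since `a` occurs once and the degree is at least two, a second letter exists; `b` below is
    -- the least such letter.
    have hne : (m.support.erase a).Nonempty := by
      by_contra h
      rw [not_nonempty_iff_eq_empty, erase_eq_empty_iff] at h
      have := card_toMultiset_le_one (m := m) (a := a) (by rcases h with h | h <;> simp [h]) h2
      omega
    have hb := min'_mem _ hne
    have h4 := card_filter_columnPairs_of_lt_two h2 hb fun x hx => min'_le _ x hx
    have h5 := card_filter_rest_add hb
    have h6 := two_mul_card_filter_mem_powerset hb
    have h7 := card_pointedBelow (m.support.erase a)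
    have h8 : 2 ^ m.support.card = 2 * 2 ^ (m.support.erase a).card := by
      rw [← card_erase_add_one ha, pow_succ, mul_comm]
    rw [filter_letterPairs_of_lt_two h2, h4]
    omega

end Counting

/-! ### Symmetry -/

/-- Pairs of a set `D` of letters, each taken once, and a remaining letter. -/
def allPairs (m : ℕ →₀ ℕ) : Finset (Finset ℕ × ℕ) :=
  (m.support.powerset ×ˢ m.support).filter fun p => p.2 ∈ p.1 → 2 ≤ m p.2

/-- The pairs excluded from `wordData` have `f` below all of `D`, and their number depends only on
the size of the support. This reduces symmetry to a count that ignores the order of the letters. -/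
lemma card_allPairs (m : ℕ →₀ ℕ) :
    (allPairs m).card + 1 = (wordData m).card + 2 ^ m.support.card := by
  rw [← card_pointedBelow, ← card_filter_add_card_filter_not (s := allPairs m)
    (fun p => ∃ x ∈ p.1, x ≤ p.2)]
  have h1 : (allPairs m).filter (fun p => ∃ x ∈ p.1, x ≤ p.2) = wordData m := by
    ext p
    simp only [allPairs, wordData, mem_filter]
    tauto
  have h2 : (allPairs m).filter (fun p => ¬ ∃ x ∈ p.1, x ≤ p.2) = pointedBelow m.support := by
    ext p
    simp only [allPairs, pointedBelow, mem_filter, not_exists, not_and, not_le]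
    constructor
    · exact fun h => ⟨h.1.1, h.2⟩
    · exact fun h => ⟨⟨h.1, fun h' => absurd (h.2 _ h') (lt_irrefl _)⟩, h.2⟩
  rw [h1, h2]
  omega

lemma mapDomain_perm_apply (σ : Equiv.Perm ℕ) (m : ℕ →₀ ℕ) (x : ℕ) :
    m.mapDomain σ (σ x) = m x := Finsupp.mapDomain_apply σ.injective m x

lemma mapDomain_perm_symm (σ : Equiv.Perm ℕ) (m : ℕ →₀ ℕ) :
    (m.mapDomain σ).mapDomain σ.symm = m := by
  rw [← Finsupp.mapDomain_comp]
  simp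

/-- One inequality suffices: applied to the inverse permutation it gives the other. -/
lemma card_allPairs_le (σ : Equiv.Perm ℕ) (m : ℕ →₀ ℕ) :
    (allPairs m).card ≤ (allPairs (m.mapDomain σ)).card := by
  refine card_le_card_of_injOn (fun p => (p.1.map σ.toEmbedding, σ p.2)) ?_ ?_
  · rintro ⟨D, f⟩ hp
    simp only [allPairs, coe_filter, mem_product, mem_powerset, Set.mem_ofPred_eq] at hp ⊢
    obtain ⟨⟨hD, hf⟩, h⟩ := hp
    have hsupp : ∀ x ∈ m.support, σ x ∈ (m.mapDomain σ).support := fun x hx => by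
      rw [Finsupp.mem_support_iff, mapDomain_perm_apply]
      exact Finsupp.mem_support_iff.1 hx
    refine ⟨⟨fun y hy => ?_, hsupp f hf⟩, fun h' => ?_⟩
    · obtain ⟨x, hx, rfl⟩ := mem_map.1 hy
      exact hsupp x (hD hx)
    · rw [mapDomain_perm_apply]
      exact h (by simpa using h')
  · rintro ⟨D, f⟩ - ⟨D', f'⟩ - h
    simp only [Prod.mk.injEq, map_inj, EmbeddingLike.apply_eq_iff_eq] at h
    exact Prod.ext h.1 h.2

lemma card_support_mapDomain (σ : Equiv.Perm ℕ) (m : ℕ →₀ ℕ) :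
    (m.mapDomain σ).support.card = m.support.card := by
  rw [Finsupp.mapDomain_support_of_injective σ.injective, card_image_of_injective _ σ.injective]

lemma card_wordData_mapDomain (σ : Equiv.Perm ℕ) (m : ℕ →₀ ℕ) :
    (wordData (m.mapDomain σ)).card = (wordData m).card := by
  have h1 := card_allPairs m
  have h2 := card_allPairs (m.mapDomain σ)
  have h3 := card_allPairs_le σ m
  have h4 := card_allPairs_le σ.symm (m.mapDomain σ)
  rw [mapDomain_perm_symm] at h4
  rw [card_support_mapDomain] at h2
  omega

lemma squarefreeIndicator_mapDomain (σ : Equiv.Perm ℕ) (m : ℕ →₀ ℕ) :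
    squarefreeIndicator (m.mapDomain σ) = squarefreeIndicator m := by
  have h : (∀ x, m.mapDomain σ x ≤ 1) ↔ ∀ x, m x ≤ 1 := by
    rw [← σ.forall_congr_right]
    simp only [mapDomain_perm_apply]
  classical
  rw [squarefreeIndicator, squarefreeIndicator]
  exact if_congr h rfl rfl

lemma isSymmetric_quasi_classK (n : ℕ) : IsSymmetric (quasi (classK n)) := by
  intro σ m
  have h : (Finsupp.toMultiset (m.mapDomain σ)).card = (Finsupp.toMultiset m).card := by
    rw [← Finsupp.toMultiset_map, Multiset.card_map]
  rw [coeff_quasi_classK_eq, coeff_quasi_classK_eq, h, card_wordData_mapDomain,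
    squarefreeIndicator_mapDomain]

/-! ### The Schur expansion -/

section Expansion

variable {m : ℕ →₀ ℕ} {a : ℕ}

lemma card_support_erase (ha : a ∈ m.support) :
    (m.support.erase a).card + 1 ≤ (Finsupp.toMultiset m).card := by
  rw [card_erase_add_one ha, ← Finset.card_val]
  exact Multiset.card_le_card (val_le_toMultiset subset_rfl)

lemma card_rest (ha : a ∈ m.support) {C : Finset ℕ} (hC : C ⊆ m.support.erase a) :
    (rest m a C).card + C.card + 1 = (Finsupp.toMultiset m).card := by
  have hins : insert a C ⊆ m.support := insert_subset ha (hC.trans (erase_subset _ _))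
  have haC : a ∉ C := fun h => notMem_erase _ _ (hC h)
  rw [rest, Multiset.card_sub (val_le_toMultiset hins), Finset.card_val, card_insert_of_notMem haC]
  have := Multiset.card_le_card (val_le_toMultiset hins)
  rw [Finset.card_val, card_insert_of_notMem haC] at this
  omega

lemma natCard_tableauData_false (k : ℕ) :
    Nat.card {x : Finset ℕ × ℕ // IsTableauData m a k false x} =
      (m.support.erase a).card.choose k := by
  rw [← card_powersetCard, ← card_map ⟨fun C => (C, 0), fun _ _ h => (Prod.mk.inj h).1⟩]
  refine Nat.subtype_card _ fun x => ?_
  rw [mem_map]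
  constructor
  · rintro ⟨C, hC, rfl⟩
    rw [mem_powersetCard] at hC
    exact ⟨hC.1, hC.2, rfl⟩
  · rintro ⟨h1, h2, h3⟩
    exact ⟨x.1, mem_powersetCard.2 ⟨h1, h2⟩, Prod.ext rfl (Eq.symm h3)⟩

lemma natCard_tableauData_true (k : ℕ) :
    Nat.card {x : Finset ℕ × ℕ // IsTableauData m a k true x} =
      ((nearHookPairs m a).filter fun x => x.1.card = k).card := by
  classical
  refine Nat.subtype_card _ fun x => ?_
  simp only [nearHookPairs, columnPairs, mem_filter, mem_letterPairs, IsTableauData, if_true]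
  tauto

lemma sum_natCard_tableauData_true (ha : a ∈ m.support) :
    ∑ k ∈ Icc 1 ((Finsupp.toMultiset m).card - 3),
      Nat.card {x : Finset ℕ × ℕ // IsTableauData m a k true x} = (nearHookPairs m a).card := by
  classical
  simp only [natCard_tableauData_true]
  refine (card_eq_sum_card_fiberwise (f := fun x : Finset ℕ × ℕ => x.1.card)
    (s := nearHookPairs m a) (t := Icc 1 ((Finsupp.toMultiset m).card - 3)) fun x hx => ?_).symm
  simp only [nearHookPairs, columnPairs, coe_filter, mem_filter, mem_letterPairs,
    Set.mem_ofPred_eq] at hx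
  obtain ⟨⟨⟨hC, hf⟩, y, hy, -⟩, z, hz, hzf⟩ := hx
  have h1 := card_rest ha hC
  have h2 : 0 < x.1.card := card_pos.2 ⟨y, hy⟩
  -- Both `f` and the smaller letter `z` remain besides `a` and the column, whence the upper bound
  -- `n - 3` on the leg.
  have h3 : 2 ≤ (rest m a x.1).card := by
    obtain ⟨t, ht⟩ := Multiset.exists_cons_of_mem hf
    have hz' : z ∈ t := by
      rw [ht, Multiset.mem_cons] at hz
      exact hz.resolve_left hzf.ne
    have := Multiset.card_pos_iff_exists_mem.2 ⟨z, hz'⟩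
    rw [ht, Multiset.card_cons]
    omega
  refine mem_Icc.2 ⟨h2, ?_⟩
  change x.1.card ≤ _
  omega

/-- This is the coefficient of the one-column Schur function: a column filling exists only when all
letters are distinct, and is then unique. -/
lemma choose_card_support (ha : a ∈ m.support) :
    (m.support.erase a).card.choose ((Finsupp.toMultiset m).card - 1) = squarefreeIndicator m := by
  have hle := val_le_toMultiset (m := m) subset_rfl
  have h1 := card_support_erase ha
  have h2 := card_erase_add_one ha
  have hsf : (∀ x, m x ≤ 1) ↔ m.support.card = (Finsupp.toMultiset m).card := by
    rw [← coe_support_sort_eq_iff, Finset.sort_eq]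
    constructor
    · intro h
      rw [← h, Finset.card_val]
    · intro h
      exact Multiset.eq_of_le_of_card_le hle (by rw [Finset.card_val, h])
  rw [squarefreeIndicator]
  split_ifs with h
  · rw [hsf] at h
    rw [show (Finsupp.toMultiset m).card - 1 = (m.support.erase a).card by omega, Nat.choose_self]
  · rw [hsf] at h
    exact Nat.choose_eq_zero_of_lt (by omega)

lemma sum_choose_card_support (ha : a ∈ m.support) (hn : 2 ≤ (Finsupp.toMultiset m).card) :
    1 + ∑ k ∈ Icc 1 ((Finsupp.toMultiset m).card - 2), (m.support.erase a).card.choose k +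
      squarefreeIndicator m = 2 ^ (m.support.erase a).card := by
  have h1 := card_support_erase ha
  rw [← choose_card_support ha, ← Nat.sum_range_choose]
  obtain ⟨N, hN⟩ : ∃ N, (Finsupp.toMultiset m).card = N + 2 := ⟨_, (Nat.sub_add_cancel hn).symm⟩
  rw [hN] at h1 ⊢
  -- Binomial coefficients beyond the size of the support vanish, so the sum may run up to the
  -- degree minus one; its first and last terms are the row and the column.
  have hsub : range ((m.support.erase a).card + 1) ⊆ range (N + 2) :=
    range_subset_range.2 (by omega)
  rw [sum_subset hsub fun k _ hk => Nat.choose_eq_zero_of_lt (by simpa using hk),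
    sum_range_succ, sum_range_succ', Nat.choose_zero_right, add_comm 1, Nat.add_sub_cancel,
    show N + 2 - 1 = N + 1 by omega]
  congr 2
  rw [← Finset.sum_image (s := range N) (g := (· + 1))
    (f := fun k => (m.support.erase a).card.choose k) (by simp)]
  congr 1
  ext k
  simp only [mem_Icc, mem_image, mem_range]
  constructor
  · exact fun h => ⟨k - 1, by omega, by omega⟩
  · rintro ⟨j, hj, rfl⟩; omega

lemma card_wordData_add_squarefree (ha : a ∈ m.support) (hmin : ∀ x ∈ m.support, a ≤ x)
    (hn : 2 ≤ (Finsupp.toMultiset m).card) :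
    (wordData m).card + squarefreeIndicator m = 1 + squarefreeIndicator m +
      2 * ∑ k ∈ Icc 1 ((Finsupp.toMultiset m).card - 2), (m.support.erase a).card.choose k +
      2 * (nearHookPairs m a).card := by
  have h1 := card_wordData_add ha hmin hn
  have h2 := sum_choose_card_support ha hn
  have h3 : 2 ^ m.support.card = 2 * 2 ^ (m.support.erase a).card := by
    rw [← card_erase_add_one ha, pow_succ, mul_comm]
  omega

end Expansion

lemma isNearHook_row {n : ℕ} (hn : 1 ≤ n) : IsNearHook (n - 1) 0 false (shape [n]) := by
  obtain ⟨n, rfl⟩ : ∃ N, n = N + 1 := ⟨_, (Nat.sub_add_cancel hn).symm⟩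
  exact isNearHook_hook n 0

lemma isNearHook_column {n : ℕ} (hn : 1 ≤ n) :
    IsNearHook 0 (n - 1) false (shape (List.replicate n 1)) := by
  obtain ⟨n, rfl⟩ : ∃ N, n = N + 1 := ⟨_, (Nat.sub_add_cancel hn).symm⟩
  exact isNearHook_hook 0 n

lemma isNearHook_hook_of_lt {n k : ℕ} (hk : k < n) :
    IsNearHook (n - k - 1) k false (shape ((n - k) :: List.replicate k 1)) := by
  have := isNearHook_hook (n - k - 1) k
  rwa [show n - k - 1 + 1 = n - k by omega] at this

lemma isNearHook_nearHook_of_le {n k : ℕ} (hk : 1 ≤ k) (hkn : k + 3 ≤ n) :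
    IsNearHook (n - k - 2) k true (shape ((n - k - 1) :: 2 :: List.replicate (k - 1) 1)) := by
  have := isNearHook_nearHook (n - k - 3) (k - 1)
  rwa [show n - k - 3 + 1 = n - k - 2 by omega, show k - 1 + 1 = k by omega,
    show n - k - 3 + 2 = n - k - 1 by omega] at this

theorem quasi_classK_eq {n : ℕ} (hn : 2 ≤ n) :
    quasi (classK n) = schur (shape [n]) + schur (shape (List.replicate n 1)) +
        2 * ∑ k ∈ Icc 1 (n - 2), schur (shape ((n - k) :: List.replicate k 1)) +
        2 * ∑ k ∈ Icc 1 (n - 3),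
          schur (shape ((n - k - 1) :: 2 :: List.replicate (k - 1) 1)) := by
  ext m
  simp only [two_mul, map_add, map_sum]
  rw [coeff_quasi_classK_eq]
  have hrow := isNearHook_row (show 1 ≤ n by omega)
  have hcol := isNearHook_column (show 1 ≤ n by omega)
  split_ifs with h
  · have hne : m.support.Nonempty := by
      rw [Finsupp.support_nonempty_iff]
      rintro rfl
      simp at h
      omega
    have ha := min'_mem _ hne
    have hmin : ∀ x ∈ m.support, m.support.min' hne ≤ x := fun x hx => min'_le _ x hx
    have hkey := card_wordData_add_squarefree ha hmin (by omega)
    rw [← sum_natCard_tableauData_true ha, h] at hkey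
    have hsf := choose_card_support ha
    rw [h] at hsf
    rw [coeff_schur_nearHook hrow ha hmin (by
        rw [h]; simp only [Bool.false_eq_true, if_false]; omega),
      coeff_schur_nearHook hcol ha hmin (by
        rw [h]; simp only [Bool.false_eq_true, if_false]; omega), natCard_tableauData_false,
      natCard_tableauData_false, hsf, hkey, Nat.choose_zero_right]
    have e1 : ∑ k ∈ Icc 1 (n - 2), MvPowerSeries.coeff m
        (schur (shape ((n - k) :: List.replicate k 1))) =
        ∑ k ∈ Icc 1 (n - 2), ((((m.support.erase (m.support.min' hne)).card.choose k : ℕ)) : ℚ) := by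
      refine sum_congr rfl fun k hk => ?_
      rw [mem_Icc] at hk
      rw [coeff_schur_nearHook (isNearHook_hook_of_lt (show k < n by omega)) ha hmin
        (by
        rw [h]; simp only [Bool.false_eq_true, if_false]; omega), natCard_tableauData_false]
    have e2 : ∑ k ∈ Icc 1 (n - 3), MvPowerSeries.coeff m
        (schur (shape ((n - k - 1) :: 2 :: List.replicate (k - 1) 1))) =
        ∑ k ∈ Icc 1 (n - 3), (Nat.card {x : Finset ℕ × ℕ //
          IsTableauData m (m.support.min' hne) k true x} : ℚ) := by
      refine sum_congr rfl fun k hk => ?_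
      rw [mem_Icc] at hk
      rw [coeff_schur_nearHook (isNearHook_nearHook_of_le hk.1 (show k + 3 ≤ n by omega)) ha hmin
        (by
        rw [h]; simp only [if_true]; omega)]
    rw [e1, e2]
    push_cast
    ring
  -- In the wrong degree both sides vanish, as every shape in the expansion has `n` cells.
  · have hz : ∀ {p k : ℕ} {q : Bool} {μ : YoungDiagram}, IsNearHook p k q μ →
        (p + k + 1 + if q = true then 1 else 0) = n → MvPowerSeries.coeff m (schur μ) = 0 := by
      intro p k q μ hμ hsum
      exact schur_apply_eq_zero (by rw [hμ.card_cells, hsum]; exact fun h' => h h'.symm)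
    have e1 : ∑ k ∈ Icc 1 (n - 2), MvPowerSeries.coeff m
        (schur (shape ((n - k) :: List.replicate k 1))) = 0 := by
      refine sum_eq_zero fun k hk => ?_
      rw [mem_Icc] at hk
      exact hz (isNearHook_hook_of_lt (show k < n by omega)) (by simp; omega)
    have e2 : ∑ k ∈ Icc 1 (n - 3), MvPowerSeries.coeff m
        (schur (shape ((n - k - 1) :: 2 :: List.replicate (k - 1) 1))) = 0 := by
      refine sum_eq_zero fun k hk => ?_
      rw [mem_Icc] at hk
      exact hz (isNearHook_nearHook_of_le hk.1 (show k + 3 ≤ n by omega)) (by simp; omega)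
    rw [hz hrow (by simp; omega), hz hcol (by simp; omega), e1, e2]
    simp

lemma card_wordData_add_squarefree_of_le_one {m : ℕ →₀ ℕ}
    (hm : (Finsupp.toMultiset m).card ≤ 1) : (wordData m).card + squarefreeIndicator m = 1 := by
  have h1 : wordData m = ∅ := by
    rw [eq_empty_iff_forall_notMem]
    intro p hp
    obtain ⟨h1, h2, x, hx, -⟩ := mem_wordData.1 hp
    have h3 := Multiset.card_pos_iff_exists_mem.2 ⟨_, h2⟩
    rw [Multiset.card_sub (val_le_toMultiset h1), Finset.card_val] at h3
    have := card_pos.2 ⟨x, hx⟩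
    omega
  have h2 : ∀ x, m x ≤ 1 := fun x => by
    rw [← Finsupp.count_toMultiset]
    exact (Multiset.count_le_card _ _).trans hm
  rw [h1, squarefreeIndicator, if_pos h2, card_empty]

lemma quasi_classK_of_le_one {n : ℕ} (hn : n ≤ 1) : quasi (classK n) = schur (shape [n]) := by
  ext m
  rw [coeff_quasi_classK_eq]
  have hcells : (shape [n]).cells.card = n := by
    rcases n with _ | n
    · rw [card_eq_zero, eq_empty_iff_forall_notMem]
      rintro ⟨i, j⟩ hc
      rw [YoungDiagram.mem_cells, mem_shape_iff (by simp)] at hc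
      cases i <;> simp at hc
    · rw [(isNearHook_row (show 1 ≤ n + 1 by omega)).card_cells]
      simp
  split_ifs with h
  · rw [card_wordData_add_squarefree_of_le_one (by omega)]
    -- Degree zero offers no least letter for `coeff_schur_nearHook`; there the diagram is empty and
    -- carries exactly one tableau.
    rcases n with _ | n
    · have hm : Finsupp.toMultiset m = 0 := Multiset.card_eq_zero.1 h
      rw [card_eq_zero] at hcells
      change _ = (Nat.card _ : ℚ)
      congr 1
      symm
      rw [Nat.card_eq_one_iff_unique]
      refine ⟨⟨fun T T' => Subtype.ext (SemistandardYoungTableau.ext fun i j => ?_)⟩,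
        ⟨⟨SemistandardYoungTableau.highestWeight _, ?_⟩⟩⟩
      · have hc : (i, j) ∉ shape [0] := by
          rw [← YoungDiagram.mem_cells, hcells]
          exact notMem_empty _
        rw [T.1.zeros hc, T'.1.zeros hc]
      · rw [sum_single_eq_iff, hcells, hm]
        rfl
    · have hne : m.support.Nonempty := by
        rw [Finsupp.support_nonempty_iff]
        rintro rfl
        simp at h
      rw [coeff_schur_nearHook (isNearHook_row (show 1 ≤ n + 1 by omega)) (min'_mem _ hne)
        (fun x hx => min'_le _ x hx) (by simpa using h), natCard_tableauData_false,
        Nat.choose_zero_right]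
  · exact (schur_apply_eq_zero (by rw [hcells]; exact fun h' => h h'.symm)).symm

/-! ### Schur positivity -/

lemma isSchurPositive_schur (μ : YoungDiagram) : IsSchurPositive (schur μ) := by
  classical
  refine ⟨Finsupp.single μ 1, fun ν => ?_, ?_⟩
  · rw [Finsupp.single_apply]
    split_ifs <;> norm_num
  · rw [Finsupp.sum_single_index] <;> simp

lemma IsSchurPositive.add {f g : MvPowerSeries ℕ ℚ} (hf : IsSchurPositive f)
    (hg : IsSchurPositive g) : IsSchurPositive (f + g) := by
  classical
  obtain ⟨c, hc, rfl⟩ := hf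
  obtain ⟨d, hd, rfl⟩ := hg
  refine ⟨c + d, fun μ => add_nonneg (hc μ) (hd μ), ?_⟩
  rw [Finsupp.sum_add_index'] <;> simp [add_smul]

lemma IsSchurPositive.sum {ι : Type*} (s : Finset ι) {f : ι → MvPowerSeries ℕ ℚ}
    (hf : ∀ i ∈ s, IsSchurPositive (f i)) : IsSchurPositive (∑ i ∈ s, f i) :=
  sum_induction f IsSchurPositive (fun _ _ => IsSchurPositive.add)
    ⟨0, fun _ => le_rfl, by simp⟩ hf

lemma isSchurPositive_quasi_classK (n : ℕ) : IsSchurPositive (quasi (classK n)) := by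
  rcases Nat.lt_or_ge n 2 with hn | hn
  · rw [quasi_classK_of_le_one (by omega)]
    exact isSchurPositive_schur _
  · have h1 := IsSchurPositive.sum (Icc 1 (n - 2))
      (f := fun k => schur (shape ((n - k) :: List.replicate k 1)))
      fun _ _ => isSchurPositive_schur _
    have h2 := IsSchurPositive.sum (Icc 1 (n - 3))
      (f := fun k => schur (shape ((n - k - 1) :: 2 :: List.replicate (k - 1) 1)))
      fun _ _ => isSchurPositive_schur _
    rw [quasi_classK_eq hn, two_mul, two_mul]
    exact (((isSchurPositive_schur _).add (isSchurPositive_schur _)).add (h1.add h1)).add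
      (h2.add h2)

end StackedGrid

theorem proposition7p8 (n : ℕ) :
    StackedGrid.IsFine (StackedGrid.classK n) ∧
    (2 ≤ n →
      StackedGrid.quasi (StackedGrid.classK n) =
        StackedGrid.schur (StackedGrid.shape [n]) +
        StackedGrid.schur (StackedGrid.shape (List.replicate n 1)) +
        2 * ∑ k ∈ Finset.Icc 1 (n - 2),
          StackedGrid.schur (StackedGrid.shape ((n - k) :: List.replicate k 1)) +
        2 * ∑ k ∈ Finset.Icc 1 (n - 3),
          StackedGrid.schur
            (StackedGrid.shape ((n - k - 1) :: 2 :: List.replicate (k - 1) 1))) :=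
  ⟨⟨StackedGrid.isSymmetric_quasi_classK n, StackedGrid.isSchurPositive_quasi_classK n⟩,
    StackedGrid.quasi_classK_eq⟩
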